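/- **Setting.** Let $(\Omega,\rho)$ be a metric space with $\operatorname{diam}(\Omega)\le 1$ and finite doubling dimension $d=\log_2 D^*$, where $D^*$ is the least $D\in\mathbb N$ such that every closed ball is contained in the union of $D$ closed balls of half its radius. Let $\mu$ be a Borel probability measure on $\Omega$, $0<\varepsilon<1$ and $n\ge(8/\varepsilon)^{d+2}$. Draw $X=(X_1,\dots,X_n)\sim\mu^n$, put $\Omega_n=\{X_1,\dots,X_n\}$ and $\mu_n=\frac1n\sum_i\delta_{X_i}$, and let $y:\Omega_n\to[0,1]$ be arbitrary labels (which may depend on the sample). For $A\subseteq\Omega$ let $$\Lambda_f(x,A)=\sup_{x'\in A\setminus\{x\}}\frac{|f(x)-f(x')|}{\rho(x,x')}\quad(\sup\emptyset=0),\qquad \overline\Lambda_f(\nu,A)=\int \Lambda_f(x,A)\,d\nu(x).$$ **Construction.** Discard $\lfloor\varepsilon n\rfloor$ of the sample points (counted with multiplicity) having the largest slopes $\Lambda_y(X_i,\Omega_n)$, breaking ties arbitrarily; let $V$ be any $\varepsilon$-net of the set of remaining points (a subset of it whose distinct points are at distance $>\varepsilon$, and such that every remaining point is within $\varepsilon$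 of $V$); let $f:\Omega\to\mathbb R$ be the pointwise minimum slope extension (PMSE) of $y$ from $V$. That is, with $R_x(u,v)=\frac{y(v)-y(u)}{\rho(x,v)+\rho(x,u)}$ (read as $0$ if $u=v=x$), $F_x(u,v)=y(u)+R_x(u,v)\rho(x,u)$, $R_x^*=\max_{u,v\in V}R_x(u,v)$ and $\Phi_x(\delta)=\{F_x(u,v): u,v\in V,\ R_x(u,v)>R_x^*-\delta\}$, $$f(x)=\lim_{\delta\to0^+}\sup\Phi_x(\delta)=\lim_{\delta\to0^+}\inf\Phi_x(\delta)\qquad(x\in\Omega).$$ **Claim.** 1. *Algorithm.* There are a fixed program and an absolute constant $C$, not depending on any of the above data, such that the program, given $n$, $\varepsilon$, the labels $y(X_i)$ and access to distances, computes such an $f$: a preprocessing stage takes at most $Cn^2$ steps, after which $f(x)$ is evaluated at any given $x\in\Omega$ in at most $Cn^2$ steps. (Unit-cost exact real arithmetic and comparisons; a distance between two sample points, or between $x$ and a sample point, is obtained in one step.) 2. For every sample $X$, all labels $y$ and every $f$ obtained by the construction (for any tie-breaking and any net), $f$ takes values in $[0,1]$, $x\mapsto\Lambda_f(x,\Omega)$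 is measurable, and $$\|f-y\|_{L_1(\mu_n)}\le 3\varepsilon\,\bigl(1\vee\overline\Lambda_y(\mu_n,\Omega_n)\bigr).$$ 3. With probability at least $1-\exp\bigl(-n(\varepsilon/8)^{d+1}+d\log(8/\varepsilon)\bigr)$ over $X\sim\mu^n$, simultaneously for all labels $y:\Omega_n\to[0,1]$ and every $f$ obtained by the construction, $$\overline\Lambda_f(\mu,\Omega)\le 5\,\overline\Lambda_y(\mu_n,\Omega_n).$$ -/

import Mathlib

open MeasureTheory Set Filter Topology
open scoped ENNReal NNReal

universe u

namespace AvgSlope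

/-! ### Doubling dimension -/

section Doubling

variable (Ω : Type u) [MetricSpace Ω]

/-- Every closed ball is contained in the union of at most `D` closed balls of half the radius. -/
def IsDoublingConst (D : ℕ) : Prop :=
  ∀ (x : Ω) (r : ℝ), 0 < r → ∃ s : Finset Ω, s.card ≤ D ∧
    Metric.closedBall x r ⊆ ⋃ c ∈ s, Metric.closedBall c (r / 2)

/-- The metric space is doubling, i.e. its doubling dimension is finite. -/
def IsDoubling : Prop := ∃ D : ℕ, IsDoublingConst Ω D

/-- The doubling dimension: `log₂` of the smallest doubling constant
(used only for doubling spaces). -/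
noncomputable def ddim : ℝ := Real.logb 2 ((sInf {D : ℕ | IsDoublingConst Ω D} : ℕ) : ℝ)

end Doubling

section Slopes

variable {Ω : Type u} [MetricSpace Ω]

/-! ### Slopes, empirical measure, nets -/

/-- The slope `Λ_f(x, A)` of `f` at `x` with respect to `A`: the supremum of
`|f x - f x'| / ρ(x, x')` over `x' ∈ A`, `x' ≠ x` (zero if there is no such `x'`). -/
noncomputable def slope (f : Ω → ℝ) (x : Ω) (A : Set Ω) : ℝ≥0∞ :=
  ⨆ x' ∈ A \ {x}, ENNReal.ofReal (|f x - f x'| / dist x x')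

/-- The strong average slope `E_{X ∼ ν} Λ_f(X, A)`. -/
noncomputable def strongSlope [MeasurableSpace Ω] (f : Ω → ℝ) (ν : Measure Ω) (A : Set Ω) :
    ℝ≥0∞ :=
  ∫⁻ x, slope f x A ∂ν

/-- The empirical measure `μ_n` of a sample. Its support is `range X`. -/
noncomputable def empirical [MeasurableSpace Ω] {n : ℕ} (X : Fin n → Ω) : Measure Ω :=
  (n : ℝ≥0∞)⁻¹ • ∑ i, Measure.dirac (X i)

/-- `V` is a `t`-net of `B`: a subset of `B` that is a `t`-cover of `B` and whose distinct points
are at distance greater than `t`. -/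
def IsNet (t : ℝ) (B V : Set Ω) : Prop :=
  V ⊆ B ∧ Metric.IsCover t.toNNReal B V ∧ Metric.IsSeparated (ENNReal.ofReal t) V

/-! ### Pointwise minimum slope extension -/

/-- `R_x(u, v)`; it is `0` in the degenerate case `u = v = x`. -/
noncomputable def pmseR (f : Ω → ℝ) (x u v : Ω) : ℝ :=
  (f v - f u) / (dist x v + dist x u)

noncomputable def pmseF (f : Ω → ℝ) (x u v : Ω) : ℝ :=
  f u + pmseR f x u v * dist x u

/-- `R*_x`, the supremum of `R_x(u, v)` over `u, v ∈ A`. -/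
noncomputable def pmseRStar (A : Set Ω) (f : Ω → ℝ) (x : Ω) : ℝ :=
  sSup {r | ∃ u ∈ A, ∃ v ∈ A, r = pmseR f x u v}

/-- `Φ_x(δ)`: the values `F_x(u, v)` over all pairs in `A` with `R_x(u, v) > R*_x - δ`. -/
def pmsePhi (A : Set Ω) (f : Ω → ℝ) (x : Ω) (δ : ℝ) : Set ℝ :=
  {z | ∃ u ∈ A, ∃ v ∈ A, pmseRStar A f x - δ < pmseR f x u v ∧ z = pmseF f x u v}

/-- `g` is the pointwise minimum slope extension of `f` from `A` to the whole space:
`g x = lim_{δ → 0+} sup Φ_x(δ) = lim_{δ → 0+} inf Φ_x(δ)` for every `x`. If `f` is constant on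
`A`, in particular if `A` is a singleton, this says that `g` is that constant. -/
def IsPMSE (A : Set Ω) (f g : Ω → ℝ) : Prop :=
  ∀ x, Tendsto (fun δ => sSup (pmsePhi A f x δ)) (𝓝[>] 0) (𝓝 (g x)) ∧
    Tendsto (fun δ => sInf (pmsePhi A f x δ)) (𝓝[>] 0) (𝓝 (g x))

/-- `f` arises from the sample `X`, the labels `y` and `ε` by the trimmed-net construction: discard
`⌊ε n⌋` sample points (counted with multiplicity) with the largest slopes, ties broken in any way;
take any `ε`-net `V` of what is left; and let `f` be the pointwise minimum slope extension of `y`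
from `V`. -/
def IsTrimmedNetPMSE {n : ℕ} (ε : ℝ) (X : Fin n → Ω) (y f : Ω → ℝ) : Prop :=
  ∃ (T : Finset (Fin n)) (V : Set Ω),
    T.card = ⌊ε * n⌋₊ ∧
    (∀ i ∈ T, ∀ j ∉ T, slope y (X j) (range X) ≤ slope y (X i) (range X)) ∧
    IsNet ε {x | ∃ j ∉ T, x = X j} V ∧
    IsPMSE V y f

end Slopes

/-! ### The machine model

Programs of a small structured language over the reals (a real RAM with unit-cost exact arithmetic
`+, -, *, /` and comparisons, no rounding), with index registers that can only be reset, copied and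
incremented. The only access to the metric space is through oracle calls, at unit cost, that return
the distance of two sample points, or of the query point and a sample point. A program is one fixed
text, the same for all inputs and all input sizes. -/

/-- The distance oracle: `samp i j` is the distance of the `i`-th and `j`-th sample point, `query i`
that of the query point and the `i`-th sample point. -/
structure Oracle where
  samp : ℕ → ℕ → ℝ
  query : ℕ → ℝ

/-- The memory: index register `k` holds `idx k`, cell `i` of the real array `a` holds `arr a i`. -/
structure Mem where
  idx : ℕ → ℕ
  arr : ℕ → ℕ → ℝ

/-- Real expressions. Arguments `a` name arrays, arguments `k`, `l` name index registers. -/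
inductive RExp where
  | zero : RExp
  | one : RExp
  | get (a k : ℕ) : RExp
  | samp (k l : ℕ) : RExp
  | query (k : ℕ) : RExp
  | add (e₁ e₂ : RExp) : RExp
  | sub (e₁ e₂ : RExp) : RExp
  | mul (e₁ e₂ : RExp) : RExp
  | div (e₁ e₂ : RExp) : RExp

namespace RExp

/-- The value of an expression (division by zero returns zero). -/
noncomputable def val (o : Oracle) (m : Mem) : RExp → ℝ
  | zero => 0
  | one => 1
  | get a k => m.arr a (m.idx k)
  | samp k l => o.samp (m.idx k) (m.idx l)
  | query k => o.query (m.idx k)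
  | add e₁ e₂ => val o m e₁ + val o m e₂
  | sub e₁ e₂ => val o m e₁ - val o m e₂
  | mul e₁ e₂ => val o m e₁ * val o m e₂
  | div e₁ e₂ => val o m e₁ / val o m e₂

/-- The number of operations needed to evaluate an expression: its number of nodes. -/
def cost : RExp → ℕ
  | zero => 1
  | one => 1
  | get _ _ => 1
  | samp _ _ => 1
  | query _ => 1
  | add e₁ e₂ => cost e₁ + cost e₂ + 1
  | sub e₁ e₂ => cost e₁ + cost e₂ + 1
  | mul e₁ e₂ => cost e₁ + cost e₂ + 1
  | div e₁ e₂ => cost e₁ + cost e₂ + 1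

end RExp

/-- Programs. `ifReal e₁ e₂ p q` runs `p` if `e₁ < e₂` and `q` otherwise; `ifIdx k l p q` likewise
compares two index registers; `loop k p` runs `p` as many times as the value that index register
`k` has when the loop is entered. -/
inductive Prog where
  | skip : Prog
  | reset (k : ℕ) : Prog
  | incr (k : ℕ) : Prog
  | copy (k l : ℕ) : Prog
  | set (a k : ℕ) (e : RExp) : Prog
  | seq (p q : Prog) : Prog
  | ifReal (e₁ e₂ : RExp) (p q : Prog) : Prog
  | ifIdx (k l : ℕ) (p q : Prog) : Prog
  | loop (k : ℕ) (p : Prog) : Prog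

namespace Prog

open Classical in
/-- `run o p (m, t)` is the memory after `p` has been run from memory `m`, together with the step
counter, which stood at `t` at the start. -/
noncomputable def run (o : Oracle) : Prog → Mem × ℕ → Mem × ℕ
  | skip, (m, t) => (m, t + 1)
  | reset k, (m, t) => (⟨Function.update m.idx k 0, m.arr⟩, t + 1)
  | incr k, (m, t) => (⟨Function.update m.idx k (m.idx k + 1), m.arr⟩, t + 1)
  | copy k l, (m, t) => (⟨Function.update m.idx k (m.idx l), m.arr⟩, t + 1)
  | set a k e, (m, t) =>
      (⟨m.idx, Function.update m.arr a (Function.update (m.arr a) (m.idx k) (e.val o m))⟩,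
        t + e.cost + 1)
  | seq p q, s => run o q (run o p s)
  | ifReal e₁ e₂ p q, (m, t) =>
      if e₁.val o m < e₂.val o m then run o p (m, t + e₁.cost + e₂.cost + 1)
      else run o q (m, t + e₁.cost + e₂.cost + 1)
  | ifIdx k l p q, (m, t) =>
      if m.idx k < m.idx l then run o p (m, t + 1) else run o q (m, t + 1)
  | loop k p, (m, t) =>
      (fun s : Mem × ℕ => run o p (s.1, s.2 + 1))^[m.idx k] (m, t + 1)

end Prog

section Learner

variable {Ω : Type u} [MetricSpace Ω]

/-- A list of `n` reals, padded with zeros. -/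
noncomputable def pad {n : ℕ} (g : Fin n → ℝ) (i : ℕ) : ℝ :=
  if h : i < n then g ⟨i, h⟩ else 0

/-- The oracle during preprocessing: there is no query point yet. -/
noncomputable def prepOracle {n : ℕ} (X : Fin n → Ω) : Oracle where
  samp i j := pad (fun k => pad (fun l => dist (X k) (X l)) j) i
  query _ := 0

/-- The oracle while the query point `x` is processed. -/
noncomputable def queryOracle {n : ℕ} (X : Fin n → Ω) (x : Ω) : Oracle where
  samp i j := pad (fun k => pad (fun l => dist (X k) (X l)) j) i
  query i := pad (fun k => dist x (X k)) i

/-- The initial memory: index register `0` holds `n`, array `0` holds `ε` in cell `0`, array `1`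
holds the labels of the sample points, and everything else is zero. -/
noncomputable def initMem {n : ℕ} (ε : ℝ) (X : Fin n → Ω) (y : Ω → ℝ) : Mem where
  idx k := if k = 0 then n else 0
  arr a i := if a = 0 ∧ i = 0 then ε else if a = 1 then pad (fun k => y (X k)) i else 0

/-- Final memory and number of steps of the preprocessing stage. -/
noncomputable def prepRun (prep : Prog) {n : ℕ} (ε : ℝ) (X : Fin n → Ω) (y : Ω → ℝ) : Mem × ℕ :=
  prep.run (prepOracle X) (initMem ε X y, 0)

/-- Final memory and number of steps of the evaluation stage at the query point `x`, which starts
from the memory that the preprocessing stage has left. -/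
noncomputable def queryRun (prep query : Prog) {n : ℕ} (ε : ℝ) (X : Fin n → Ω) (y : Ω → ℝ)
    (x : Ω) : Mem × ℕ :=
  query.run (queryOracle X x) ((prepRun prep ε X y).1, 0)

/-- The function on the whole space that the two-stage algorithm computes: its value at `x` is read
from cell `0` of array `0` after the evaluation stage. -/
noncomputable def learned (prep query : Prog) {n : ℕ} (ε : ℝ) (X : Fin n → Ω) (y : Ω → ℝ) :
    Ω → ℝ :=
  fun x => (queryRun prep query ε X y x).1.arr 0 0

end Learner

end AvgSlope

/-! For a finite set `V`, maximality of R*_x means that at x every lower cone y(w) - R*_x ρ(x,w)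
lies below every upper cone y(w') + R*_x ρ(x,w'), and that for an optimal pair two such cones touch.
The touching value is f(x), so the extension is well defined and stays in [0,1]. Comparing cones at
two points bounds |f(x) - f(x')| by the smaller of R*_x, R*_x' times ρ(x,x'), and an optimal pair
attains the bound, so Λ_f(x,Ω) = R*_x exactly (`IsPMSE.slope_univ_eq`). Everything else is an
estimate of R*_x.

Three estimates carry the proof. At a sample point, R*_x is at most Λ_y
(`ofReal_pmseRStar_le_slope`); hence f is within 2εΛ_y of y at kept points, while the trimmed points
have mass at most ε and error at most 1. Since distinct net points are more than ε apart, R*_x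
changes by a factor of at most 2 over distances up to ε/2 (`pmseRStar_le_two_mul`). Since net points
are untrimmed, R*_x is everywhere at most the slope of each trimmed point, so |T| R*_x is at most
the total slope of the sample (`card_mul_pmseRStar_le`).

Doubling yields at most (8/ε)^d cells of diameter at most ε/2. By a Chernoff and union bound every
heavy cell contains at least half its expected share of the sample, with the stated probability. On
heavy cells, comparison with the sample points in the cell costs 4 times the empirical average
slope. The light cells have total mass at most 5ε/6 while |T| ≥ 5εn/6, so they add one more
multiple. The good event depends on cell counts only, hence serves all labels, ties and nets at
once.

The algorithm is brute force: all slopes, repeated maxima, a greedy net, and all net pairs for each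
query. Hoare triples that also bound the step count give correctness and running time together. -/

namespace AvgSlope

/-! ### Pointwise minimum slope extension from a finite set -/

section PMSE

variable {Ω : Type u} [MetricSpace Ω]

/-- The pair `(u, v)` maximizes `R_x` over `V`. -/
def IsMaxPair (V : Set Ω) (y : Ω → ℝ) (x u v : Ω) : Prop :=
  u ∈ V ∧ v ∈ V ∧ ∀ u' ∈ V, ∀ v' ∈ V, pmseR y x u' v' ≤ pmseR y x u v

theorem exists_isMaxPair {V : Set Ω} (hV : V.Finite) (hne : V.Nonempty) (y : Ω → ℝ) (x : Ω) :
    ∃ u v, IsMaxPair V y x u v := by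
  obtain ⟨p, hp, hmax⟩ := Set.exists_max_image (V ×ˢ V) (fun p => pmseR y x p.1 p.2)
    (hV.prod hV) (hne.prod hne)
  exact ⟨p.1, p.2, hp.1, hp.2, fun u' hu' v' hv' => hmax (u', v') ⟨hu', hv'⟩⟩

theorem IsMaxPair.pmseRStar_eq {V : Set Ω} {y : Ω → ℝ} {x u v : Ω} (h : IsMaxPair V y x u v) :
    pmseRStar V y x = pmseR y x u v := by
  refine IsGreatest.csSup_eq ⟨⟨u, h.1, v, h.2.1, rfl⟩, ?_⟩
  rintro _ ⟨u', hu', v', hv', rfl⟩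
  exact h.2.2 u' hu' v' hv'

theorem IsMaxPair.nonneg {V : Set Ω} {y : Ω → ℝ} {x u v : Ω} (h : IsMaxPair V y x u v) :
    0 ≤ pmseR y x u v := by
  have := h.2.2 u h.1 u h.1
  simpa [pmseR] using this

/-- Clearing the denominator of R_x turns a bound on it into the order of two cones at x. A zero
denominator forces u = v = x, where both cones have the same value. -/
theorem sub_le_of_pmseR_le {y : Ω → ℝ} {x u v : Ω} {R : ℝ} (h : pmseR y x u v ≤ R) :
    y v - R * dist x v ≤ y u + R * dist x u := by
  rcases (add_nonneg (dist_nonneg (x := x) (y := v)) (dist_nonneg (x := x) (y := u))).eq_or_lt with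
    h0 | h0
  · have hv : dist x v = 0 := by linarith [dist_nonneg (x := x) (y := v), dist_nonneg (x := x) (y := u)]
    have hu : dist x u = 0 := by linarith
    have : v = u := (dist_eq_zero.1 hv).symm.trans (dist_eq_zero.1 hu)
    subst this
    rw [hv]; linarith
  · rw [pmseR, div_le_iff₀ h0] at h
    linarith

theorem pmseF_eq (y : Ω → ℝ) (x u v : Ω) :
    pmseF y x u v = y v - pmseR y x u v * dist x v := by
  rw [pmseF]
  refine le_antisymm ?_ (sub_le_of_pmseR_le le_rfl)
  rcases (add_nonneg (dist_nonneg (x := x) (y := v)) (dist_nonneg (x := x) (y := u))).eq_or_lt with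
    h0 | h0
  · have hv : dist x v = 0 := by linarith [dist_nonneg (x := x) (y := v), dist_nonneg (x := x) (y := u)]
    have hu : dist x u = 0 := by linarith
    have : v = u := (dist_eq_zero.1 hv).symm.trans (dist_eq_zero.1 hu)
    subst this
    rw [hv]; linarith
  · have : pmseR y x u v * (dist x v + dist x u) = y v - y u := div_mul_cancel₀ _ h0.ne'
    linarith

/-- By `pmseF_eq` the value can be read off at v as well; the pair (w, v) is then compared with the
optimal one. -/
theorem IsMaxPair.pmseF_le {V : Set Ω} {y : Ω → ℝ} {x u v w : Ω} (h : IsMaxPair V y x u v)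
    (hw : w ∈ V) : pmseF y x u v ≤ y w + pmseR y x u v * dist x w := by
  rw [pmseF_eq]
  exact sub_le_of_pmseR_le (h.2.2 w hw v h.2.1)

theorem IsMaxPair.le_pmseF {V : Set Ω} {y : Ω → ℝ} {x u v w : Ω} (h : IsMaxPair V y x u v)
    (hw : w ∈ V) : y w - pmseR y x u v * dist x w ≤ pmseF y x u v :=
  sub_le_of_pmseR_le (h.2.2 u h.1 w hw)

/-- The value at one optimal pair lies on an upper cone that bounds the value at any other, with the
same slope; by symmetry the two agree. -/
theorem IsMaxPair.pmseF_unique {V : Set Ω} {y : Ω → ℝ} {x u v u' v' : Ω}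
    (h : IsMaxPair V y x u v) (h' : IsMaxPair V y x u' v') :
    pmseF y x u v = pmseF y x u' v' := by
  have hR : pmseR y x u v = pmseR y x u' v' := h.pmseRStar_eq.symm.trans h'.pmseRStar_eq
  refine le_antisymm ?_ ?_
  · have := h.pmseF_le h'.1
    rwa [hR] at this
  · have := h'.pmseF_le h.1
    rwa [← hR] at this

/-- For a finite set `V` the values `Φ_x(δ)` collapse to a single one as `δ → 0+`. -/
theorem IsMaxPair.eventually_pmsePhi_eq {V : Set Ω} (hV : V.Finite) {y : Ω → ℝ} {x u v : Ω}
    (h : IsMaxPair V y x u v) : ∀ᶠ δ in 𝓝[>] (0 : ℝ), pmsePhi V y x δ = {pmseF y x u v} := by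
  -- A pair that is not optimal misses the maximum by a positive gap and leaves Φ_x(δ) once δ is
  -- below it; finiteness of `V` makes this uniform over pairs.
  have hev : ∀ᶠ δ in 𝓝[>] (0 : ℝ), ∀ p ∈ V ×ˢ V,
      pmseRStar V y x - δ < pmseR y x p.1 p.2 → pmseR y x u v ≤ pmseR y x p.1 p.2 := by
    rw [Filter.eventually_all_finite (hV.prod hV)]
    rintro ⟨u', v'⟩ -
    rcases le_or_gt (pmseR y x u v) (pmseR y x u' v') with hle | hlt
    · exact Eventually.of_forall fun _ _ => hle
    · have : ∀ᶠ δ in 𝓝[>] (0 : ℝ), δ < pmseR y x u v - pmseR y x u' v' :=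
        nhdsWithin_le_nhds (gt_mem_nhds (by linarith))
      filter_upwards [this] with δ hδ hgt
      rw [h.pmseRStar_eq] at hgt
      exact absurd hgt (by linarith)
  filter_upwards [hev, self_mem_nhdsWithin] with δ hδ hpos
  ext z
  constructor
  · rintro ⟨u', hu', v', hv', hgt, rfl⟩
    have hle := hδ (u', v') ⟨hu', hv'⟩ hgt
    have h' : IsMaxPair V y x u' v' :=
      ⟨hu', hv', fun a ha b hb => (h.2.2 a ha b hb).trans hle⟩
    exact h'.pmseF_unique h
  · rintro rfl
    refine ⟨u, h.1, v, h.2.1, ?_, rfl⟩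
    rw [h.pmseRStar_eq]
    have : 0 < δ := hpos
    linarith

theorem isPMSE_iff {V : Set Ω} (hV : V.Finite) (hne : V.Nonempty) {y g : Ω → ℝ} :
    IsPMSE V y g ↔ ∀ x u v, IsMaxPair V y x u v → g x = pmseF y x u v := by
  constructor
  · intro hg x u v h
    refine tendsto_nhds_unique (hg x).1 (tendsto_const_nhds.congr' ?_)
    filter_upwards [h.eventually_pmsePhi_eq hV] with δ hδ
    rw [hδ, csSup_singleton]
  · intro hg x
    obtain ⟨u, v, h⟩ := exists_isMaxPair hV hne y x
    have hx := hg x u v h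
    constructor
    all_goals
      refine (tendsto_const_nhds (x := g x)).congr' ?_
      filter_upwards [h.eventually_pmsePhi_eq hV] with δ hδ
      rw [hδ, hx]
    · exact (csSup_singleton _).symm
    · exact (csInf_singleton _).symm

variable {V : Set Ω} {y f : Ω → ℝ}

theorem pmseR_le_pmseRStar (hV : V.Finite) (hne : V.Nonempty) {x u v : Ω} (hu : u ∈ V)
    (hv : v ∈ V) : pmseR y x u v ≤ pmseRStar V y x := by
  obtain ⟨a, b, h⟩ := exists_isMaxPair hV hne y x
  rw [h.pmseRStar_eq]
  exact h.2.2 u hu v hv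

theorem pmseRStar_nonneg (hV : V.Finite) (hne : V.Nonempty) (x : Ω) : 0 ≤ pmseRStar V y x := by
  obtain ⟨a, b, h⟩ := exists_isMaxPair hV hne y x
  rw [h.pmseRStar_eq]
  exact h.nonneg

theorem IsPMSE.le_add (hf : IsPMSE V y f) (hV : V.Finite) {w : Ω} (hw : w ∈ V) (x : Ω) :
    f x ≤ y w + pmseRStar V y x * dist x w := by
  obtain ⟨a, b, h⟩ := exists_isMaxPair hV ⟨w, hw⟩ y x
  rw [(isPMSE_iff hV ⟨w, hw⟩).1 hf x a b h, h.pmseRStar_eq]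
  exact h.pmseF_le hw

theorem IsPMSE.sub_le (hf : IsPMSE V y f) (hV : V.Finite) {w : Ω} (hw : w ∈ V) (x : Ω) :
    y w - pmseRStar V y x * dist x w ≤ f x := by
  obtain ⟨a, b, h⟩ := exists_isMaxPair hV ⟨w, hw⟩ y x
  rw [(isPMSE_iff hV ⟨w, hw⟩).1 hf x a b h, h.pmseRStar_eq]
  exact h.le_pmseF hw

theorem IsPMSE.eq_on (hf : IsPMSE V y f) (hV : V.Finite) {w : Ω} (hw : w ∈ V) : f w = y w := by
  have h1 := hf.le_add hV hw w
  have h2 := hf.sub_le hV hw w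
  simp only [dist_self, mul_zero, add_zero, sub_zero] at h1 h2
  exact le_antisymm h1 h2

theorem IsPMSE.mem_Icc (hf : IsPMSE V y f) (hV : V.Finite) (hne : V.Nonempty)
    (hy : MapsTo y V (Icc 0 1)) (x : Ω) : f x ∈ Icc (0 : ℝ) 1 := by
  obtain ⟨u, v, h⟩ := exists_isMaxPair hV hne y x
  have hfx := (isPMSE_iff hV hne).1 hf x u v h
  have h1 : f x = y u + pmseR y x u v * dist x u := hfx
  have h2 : f x = y v - pmseR y x u v * dist x v := hfx.trans (pmseF_eq y x u v)
  have hu := mul_nonneg h.nonneg (dist_nonneg (x := x) (y := u))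
  have hv := mul_nonneg h.nonneg (dist_nonneg (x := x) (y := v))
  have hyu := hy h.1
  have hyv := hy h.2.1
  exact ⟨by linarith [hyu.1], by linarith [hyv.2]⟩

/-- With (u, v) optimal at x, f(x) lies on cones at u and v of the steeper slope R*_x, while f(x')
obeys the cone bounds at u and v with the flatter slope. Only the flatter slope is paid for the move
from x to x'. -/
theorem IsPMSE.abs_sub_le_of_le (hf : IsPMSE V y f) (hV : V.Finite) (hne : V.Nonempty) {x x' : Ω}
    (hle : pmseRStar V y x' ≤ pmseRStar V y x) :
    |f x - f x'| ≤ pmseRStar V y x' * dist x x' := by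
  obtain ⟨u, v, h⟩ := exists_isMaxPair hV hne y x
  have hfx := (isPMSE_iff hV hne).1 hf x u v h
  have h1 : f x = y u + pmseRStar V y x * dist x u := by rw [h.pmseRStar_eq]; exact hfx
  have h2 : f x = y v - pmseRStar V y x * dist x v := by
    rw [h.pmseRStar_eq]; exact hfx.trans (pmseF_eq y x u v)
  have hu := hf.le_add hV h.1 x'
  have hv := hf.sub_le hV h.2.1 x'
  have h0 : 0 ≤ pmseRStar V y x' := pmseRStar_nonneg hV hne x'
  have tu : pmseRStar V y x' * dist x' u ≤ pmseRStar V y x' * dist x x' +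
      pmseRStar V y x * dist x u := by
    calc _ ≤ pmseRStar V y x' * (dist x x' + dist x u) := by
          refine mul_le_mul_of_nonneg_left ?_ h0
          rw [dist_comm x x']; exact dist_triangle _ _ _
      _ = pmseRStar V y x' * dist x x' + pmseRStar V y x' * dist x u := mul_add _ _ _
      _ ≤ _ := by gcongr
  have tv : pmseRStar V y x' * dist x' v ≤ pmseRStar V y x' * dist x x' +
      pmseRStar V y x * dist x v := by
    calc _ ≤ pmseRStar V y x' * (dist x x' + dist x v) := by
          refine mul_le_mul_of_nonneg_left ?_ h0
          rw [dist_comm x x']; exact dist_triangle _ _ _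
      _ = pmseRStar V y x' * dist x x' + pmseRStar V y x' * dist x v := mul_add _ _ _
      _ ≤ _ := by gcongr
  rw [abs_le]
  constructor <;> linarith

/-- The pointwise minimum slope extension has local slope at most `R*_x`. -/
theorem IsPMSE.abs_sub_le (hf : IsPMSE V y f) (hV : V.Finite) (hne : V.Nonempty) (x x' : Ω) :
    |f x - f x'| ≤ pmseRStar V y x * dist x x' := by
  rcases le_total (pmseRStar V y x') (pmseRStar V y x) with h | h
  · exact (hf.abs_sub_le_of_le hV hne h).trans (by gcongr)
  · have := hf.abs_sub_le_of_le hV hne h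
    rwa [abs_sub_comm, dist_comm] at this

/-- Since f = y on `V`, an endpoint of an optimal pair that differs from x realizes the slope R*_x.
If both endpoints equal x, then R*_x = 0. -/
theorem IsPMSE.slope_univ_eq (hf : IsPMSE V y f) (hV : V.Finite) (hne : V.Nonempty) (x : Ω) :
    slope f x univ = ENNReal.ofReal (pmseRStar V y x) := by
  apply le_antisymm
  · refine iSup₂_le fun x' hx' => ENNReal.ofReal_le_ofReal ?_
    have : 0 < dist x x' := dist_pos.2 fun h => hx'.2 h.symm
    rw [div_le_iff₀ this]
    exact hf.abs_sub_le hV hne x x'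
  · obtain ⟨u, v, h⟩ := exists_isMaxPair hV hne y x
    rw [h.pmseRStar_eq]
    have hfx := (isPMSE_iff hV hne).1 hf x u v h
    have h1 : f x = y u + pmseR y x u v * dist x u := hfx
    have h2 : f x = y v - pmseR y x u v * dist x v := hfx.trans (pmseF_eq y x u v)
    have key : ∀ w ∈ V, w ≠ x → |f x - y w| = pmseR y x u v * dist x w →
        ENNReal.ofReal (pmseR y x u v) ≤ slope f x univ := by
      intro w hw hwx habs
      refine le_trans (le_of_eq ?_) (le_iSup₂ (f := fun x' (_ : x' ∈ univ \ {x}) =>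
        ENNReal.ofReal (|f x - f x'| / dist x x')) w ⟨mem_univ w, hwx⟩)
      have : dist x w ≠ 0 := (dist_pos.2 hwx.symm).ne'
      rw [hf.eq_on hV hw, habs, mul_div_cancel_right₀ _ this]
    by_cases hu : u = x
    · by_cases hv : v = x
      · have : pmseR y x u v = 0 := by rw [pmseR, hu, hv]; simp
        rw [this]; simp
      · refine key v h.2.1 hv ?_
        rw [h2, show y v - pmseR y x u v * dist x v - y v = -(pmseR y x u v * dist x v) by ring,
          abs_neg, abs_of_nonneg (mul_nonneg h.nonneg dist_nonneg)]
    · refine key u h.1 hu ?_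
      rw [h1, add_sub_cancel_left, abs_of_nonneg (mul_nonneg h.nonneg dist_nonneg)]

/-- A maximum of finitely many measurable functions: its superlevel sets are finite unions. -/
theorem measurable_pmseRStar [MeasurableSpace Ω] [BorelSpace Ω] (hV : V.Finite)
    (hne : V.Nonempty) : Measurable (pmseRStar V y) := by
  refine measurable_of_Ioi fun c => ?_
  have : pmseRStar V y ⁻¹' Ioi c = ⋃ u ∈ V, ⋃ v ∈ V, {x | c < pmseR y x u v} := by
    ext x
    simp only [mem_preimage, mem_Ioi, mem_iUnion, mem_ofPred_eq, exists_prop]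
    constructor
    · intro hc
      obtain ⟨u, v, h⟩ := exists_isMaxPair hV hne y x
      exact ⟨u, h.1, v, h.2.1, by rwa [← h.pmseRStar_eq]⟩
    · rintro ⟨u, hu, v, hv, hc⟩
      exact hc.trans_le (pmseR_le_pmseRStar hV hne hu hv)
  rw [this]
  refine MeasurableSet.biUnion hV.countable fun u _ => MeasurableSet.biUnion hV.countable
    fun v _ => ?_
  refine measurableSet_lt measurable_const ?_
  unfold pmseR
  exact measurable_const.div ((continuous_id.dist continuous_const).measurable.add
    (continuous_id.dist continuous_const).measurable)

theorem abs_sub_le_slope_mul (y : Ω → ℝ) {A : Set Ω} {x w : Ω} (hw : w ∈ A) :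
    ENNReal.ofReal |y x - y w| ≤ slope y x A * ENNReal.ofReal (dist x w) := by
  rcases eq_or_ne w x with rfl | hne
  · simp
  · have hpos : 0 < dist x w := dist_pos.2 hne.symm
    calc ENNReal.ofReal |y x - y w|
        = ENNReal.ofReal (|y x - y w| / dist x w) * ENNReal.ofReal (dist x w) := by
          rw [← ENNReal.ofReal_mul (by positivity), div_mul_cancel₀ _ hpos.ne']
      _ ≤ _ := by
          gcongr
          exact le_iSup₂ (f := fun x' (_ : x' ∈ A \ {x}) =>
            ENNReal.ofReal (|y x - y x'| / dist x x')) w ⟨hw, hne⟩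

end PMSE

/-- No measurability of `g` is needed, because singletons are measurable; this matters since the
labels are arbitrary. -/
theorem lintegral_empirical {Ω : Type u} [MeasurableSpace Ω] [MeasurableSingletonClass Ω]
    {n : ℕ} (X : Fin n → Ω) (g : Ω → ℝ≥0∞) :
    ∫⁻ x, g x ∂(empirical X) = (n : ℝ≥0∞)⁻¹ * ∑ i, g (X i) := by
  rw [empirical, lintegral_smul_measure, lintegral_finsetSum_measure]
  simp [lintegral_dirac]

/-! ### The trimmed net and the empirical error -/

section Trimmed

variable {Ω : Type u} [MetricSpace Ω]

/-- Passing from u to v through x changes y by at most Λ_y(x, A) (ρ(x,u) + ρ(x,v)), and the bracket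
is the denominator of R_x(u, v). -/
theorem ofReal_pmseRStar_le_slope {V A : Set Ω} (hV : V.Finite) (hne : V.Nonempty) (hVA : V ⊆ A)
    (y : Ω → ℝ) (x : Ω) : ENNReal.ofReal (pmseRStar V y x) ≤ slope y x A := by
  rcases eq_or_ne (slope y x A) ⊤ with htop | htop
  · rw [htop]; exact le_top
  obtain ⟨u, v, h⟩ := exists_isMaxPair hV hne y x
  rw [h.pmseRStar_eq, ENNReal.ofReal_le_iff_le_toReal htop]
  have key : ∀ w ∈ V, |y x - y w| ≤ (slope y x A).toReal * dist x w := by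
    intro w hw
    have := abs_sub_le_slope_mul y (x := x) (hVA hw)
    rw [ENNReal.ofReal_le_iff_le_toReal (ENNReal.mul_ne_top htop ENNReal.ofReal_ne_top),
      ENNReal.toReal_mul, ENNReal.toReal_ofReal dist_nonneg] at this
    exact this
  refine div_le_of_le_mul₀ (by positivity) ENNReal.toReal_nonneg ?_
  have hu := (abs_le.1 (key u h.1)).2
  have hv := (abs_le.1 (key v h.2.1)).1
  linarith

/-- The data behind the trimmed-net construction, with the properties of the net unfolded. -/
structure TrimmedNet {n : ℕ} (ε : ℝ) (X : Fin n → Ω) (y f : Ω → ℝ) (T : Finset (Fin n))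
    (V : Set Ω) : Prop where
  card_eq : T.card = ⌊ε * n⌋₊
  slope_le : ∀ i ∈ T, ∀ j ∉ T, slope y (X j) (range X) ≤ slope y (X i) (range X)
  exists_eq : ∀ v ∈ V, ∃ j ∉ T, v = X j
  cover : ∀ j ∉ T, ∃ v ∈ V, dist (X j) v ≤ ε
  separated : ∀ u ∈ V, ∀ v ∈ V, u ≠ v → ε < dist u v
  isPMSE : IsPMSE V y f

theorem isTrimmedNetPMSE_iff {n : ℕ} {ε : ℝ} (hε : 0 < ε) {X : Fin n → Ω} {y f : Ω → ℝ} :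
    IsTrimmedNetPMSE ε X y f ↔ ∃ T V, TrimmedNet ε X y f T V := by
  refine exists_congr fun T => exists_congr fun V => ?_
  have hsep : Metric.IsSeparated (ENNReal.ofReal ε) V ↔
      ∀ u ∈ V, ∀ v ∈ V, u ≠ v → ε < dist u v := by
    refine forall₅_congr fun u _ v _ huv => ?_
    show ENNReal.ofReal ε < edist u v ↔ ε < dist u v
    rw [edist_dist, ENNReal.ofReal_lt_ofReal_iff (dist_pos.2 huv)]
  have hcov : Metric.IsCover ε.toNNReal {x | ∃ j ∉ T, x = X j} V ↔
      ∀ j ∉ T, ∃ v ∈ V, dist (X j) v ≤ ε := by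
    rw [Metric.isCover_iff_subset_iUnion_closedBall]
    simp only [subset_def, mem_ofPred_eq, mem_iUnion, Metric.mem_closedBall, exists_prop,
      Real.coe_toNNReal _ hε.le]
    constructor
    · exact fun h j hj => h _ ⟨j, hj, rfl⟩
    · rintro h _ ⟨j, hj, rfl⟩
      exact h j hj
  constructor
  · rintro ⟨h1, h2, ⟨h3, h4, h5⟩, h6⟩
    exact ⟨h1, h2, h3, hcov.1 h4, hsep.1 h5, h6⟩
  · rintro ⟨h1, h2, h3, h4, h5, h6⟩
    exact ⟨h1, h2, ⟨h3, hcov.2 h4, hsep.2 h5⟩, h6⟩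

namespace TrimmedNet

variable {n : ℕ} {ε : ℝ} {X : Fin n → Ω} {y f : Ω → ℝ} {T : Finset (Fin n)} {V : Set Ω}

theorem subset_range (h : TrimmedNet ε X y f T V) : V ⊆ range X := fun v hv => by
  obtain ⟨j, -, rfl⟩ := h.exists_eq v hv
  exact mem_range_self j

theorem finite (h : TrimmedNet ε X y f T V) : V.Finite := (finite_range X).subset h.subset_range

theorem nonempty (h : TrimmedNet ε X y f T V) (hε : 0 < ε) (hε1 : ε < 1) (hn : 0 < n) :
    V.Nonempty := by
  have hn' : (0 : ℝ) < n := by exact_mod_cast hn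
  have hlt : T.card < n := by
    rw [h.card_eq, Nat.floor_lt (by positivity)]
    nlinarith
  have : ∃ j, j ∉ T := by
    by_contra! hall
    rw [Finset.eq_univ_iff_forall.2 hall, Finset.card_univ, Fintype.card_fin] at hlt
    exact lt_irrefl _ hlt
  obtain ⟨j, hj⟩ := this
  obtain ⟨v, hv, -⟩ := h.cover j hj
  exact ⟨v, hv⟩

/-- A net point within ε of X_j is reached by f at slope R* ≤ Λ_y and left by y at slope Λ_y, hence
2ε. -/
theorem ofReal_abs_sub_le (h : TrimmedNet ε X y f T V) {j : Fin n} (hj : j ∉ T) (hε : 0 < ε) :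
    ENNReal.ofReal |f (X j) - y (X j)| ≤
      ENNReal.ofReal (2 * ε) * slope y (X j) (range X) := by
  obtain ⟨v, hv, hd⟩ := h.cover j hj
  have hne : V.Nonempty := ⟨v, hv⟩
  have hf1 := h.isPMSE.le_add h.finite hv (X j)
  have hf2 := h.isPMSE.sub_le h.finite hv (X j)
  have h1 : |f (X j) - y v| ≤ pmseRStar V y (X j) * ε := by
    have : pmseRStar V y (X j) * dist (X j) v ≤ pmseRStar V y (X j) * ε := by
      gcongr
      exact pmseRStar_nonneg h.finite hne _
    rw [abs_le]; constructor <;> linarith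
  calc ENNReal.ofReal |f (X j) - y (X j)|
      ≤ ENNReal.ofReal (pmseRStar V y (X j) * ε + |y (X j) - y v|) := by
        refine ENNReal.ofReal_le_ofReal ?_
        have := abs_sub_le (f (X j)) (y v) (y (X j))
        rw [abs_sub_comm (y v)] at this
        linarith
    _ = ENNReal.ofReal (pmseRStar V y (X j)) * ENNReal.ofReal ε +
          ENNReal.ofReal |y (X j) - y v| := by
        rw [ENNReal.ofReal_add (mul_nonneg (pmseRStar_nonneg h.finite hne _) hε.le)
          (abs_nonneg _), ENNReal.ofReal_mul (pmseRStar_nonneg h.finite hne _)]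
    _ ≤ slope y (X j) (range X) * ENNReal.ofReal ε +
          slope y (X j) (range X) * ENNReal.ofReal ε := by
        gcongr
        · exact ofReal_pmseRStar_le_slope h.finite hne h.subset_range y _
        · refine (abs_sub_le_slope_mul y (h.subset_range hv)).trans ?_
          gcongr
    _ = _ := by
        rw [two_mul, ENNReal.ofReal_add hε.le hε.le]
        ring

theorem eLpNorm_le [MeasurableSpace Ω] [BorelSpace Ω] (h : TrimmedNet ε X y f T V) (hε : 0 < ε)
    (hε1 : ε < 1) (hn : 0 < n) (hy : MapsTo y (range X) (Icc 0 1)) :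
    eLpNorm (fun x => f x - y x) 1 (empirical X) ≤
      ENNReal.ofReal (3 * ε) * max 1 (strongSlope y (empirical X) (range X)) := by
  have hV := h.finite
  have hne := h.nonempty hε hε1 hn
  have hn' : (0 : ℝ) < n := by exact_mod_cast hn
  have hn0 : (n : ℝ≥0∞) ≠ 0 := by exact_mod_cast hn.ne'
  have hnt : (n : ℝ≥0∞) ≠ ⊤ := ENNReal.natCast_ne_top n
  rw [eLpNorm_one_eq_lintegral_enorm, lintegral_empirical, strongSlope, lintegral_empirical]
  set S := ∑ i, slope y (X i) (range X) with hS
  -- At trimmed points only the trivial bound 1 holds, both functions being [0,1]-valued there; they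
  -- supply the third ε.
  have hT : ∑ i ∈ T, ‖f (X i) - y (X i)‖ₑ ≤ ENNReal.ofReal ε * n := by
    calc ∑ i ∈ T, ‖f (X i) - y (X i)‖ₑ ≤ ∑ i ∈ T, 1 := by
          refine Finset.sum_le_sum fun i _ => ?_
          rw [Real.enorm_eq_ofReal_abs, ← ENNReal.ofReal_one]
          refine ENNReal.ofReal_le_ofReal ?_
          have hf := h.isPMSE.mem_Icc hV hne (hy.mono_left h.subset_range) (X i)
          have hyi := hy (mem_range_self i)
          rw [abs_le]
          constructor <;> linarith [hf.1, hf.2, hyi.1, hyi.2]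
      _ = ENNReal.ofReal (T.card : ℝ) := by simp
      _ ≤ ENNReal.ofReal (ε * n) := by
          refine ENNReal.ofReal_le_ofReal ?_
          rw [h.card_eq]
          exact Nat.floor_le (by positivity)
      _ = _ := by rw [ENNReal.ofReal_mul hε.le, ENNReal.ofReal_natCast]
  have hTc : ∑ i ∈ Tᶜ, ‖f (X i) - y (X i)‖ₑ ≤ ENNReal.ofReal (2 * ε) * S := by
    calc ∑ i ∈ Tᶜ, ‖f (X i) - y (X i)‖ₑ
        ≤ ∑ i ∈ Tᶜ, ENNReal.ofReal (2 * ε) * slope y (X i) (range X) := by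
          refine Finset.sum_le_sum fun i hi => ?_
          rw [Real.enorm_eq_ofReal_abs]
          exact h.ofReal_abs_sub_le (Finset.mem_compl.1 hi) hε
      _ ≤ ∑ i, ENNReal.ofReal (2 * ε) * slope y (X i) (range X) :=
          Finset.sum_le_sum_of_subset (Finset.subset_univ _)
      _ = _ := by rw [hS, Finset.mul_sum]
  rw [← Finset.sum_add_sum_compl T]
  calc (n : ℝ≥0∞)⁻¹ * (∑ i ∈ T, ‖f (X i) - y (X i)‖ₑ + ∑ i ∈ Tᶜ, ‖f (X i) - y (X i)‖ₑ)
      ≤ (n : ℝ≥0∞)⁻¹ * (ENNReal.ofReal ε * n + ENNReal.ofReal (2 * ε) * S) := by gcongr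
    _ = ENNReal.ofReal ε * ((n : ℝ≥0∞)⁻¹ * n) +
          ENNReal.ofReal (2 * ε) * ((n : ℝ≥0∞)⁻¹ * S) := by ring
    _ ≤ ENNReal.ofReal ε * max 1 ((n : ℝ≥0∞)⁻¹ * S) +
          ENNReal.ofReal (2 * ε) * max 1 ((n : ℝ≥0∞)⁻¹ * S) := by
        rw [ENNReal.inv_mul_cancel hn0 hnt]
        gcongr
        · exact le_max_left _ _
        · exact le_max_right _ _
    _ = _ := by
        rw [← add_mul, ← ENNReal.ofReal_add hε.le (by positivity)]
        congr 2
        ring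

end TrimmedNet

end Trimmed

/-! ### Partitions of doubling spaces into small cells -/

section Partition

variable {Ω : Type u} [MetricSpace Ω]

/-- Doubling makes the infimum in `ddim` attained and nonemptiness makes it positive, so the
logarithm can be inverted. -/
theorem IsDoubling.exists_isDoublingConst [Nonempty Ω] (h : IsDoubling Ω) :
    ∃ D : ℕ, IsDoublingConst Ω D ∧ 0 < D ∧ (2 : ℝ) ^ ddim Ω = D := by
  have hD : IsDoublingConst Ω (sInf {D : ℕ | IsDoublingConst Ω D}) := Nat.sInf_mem h
  have hpos : 0 < sInf {D : ℕ | IsDoublingConst Ω D} := by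
    obtain ⟨x⟩ := ‹Nonempty Ω›
    obtain ⟨s, hs, hcov⟩ := hD x 1 one_pos
    have := hcov (Metric.mem_closedBall_self zero_le_one)
    simp only [mem_iUnion, exists_prop] at this
    obtain ⟨c, hc, -⟩ := this
    exact (Finset.card_pos.2 ⟨c, hc⟩).trans_le hs
  refine ⟨_, hD, hpos, ?_⟩
  rw [ddim, Real.rpow_logb two_pos (by norm_num)]
  exact_mod_cast hpos

theorem IsDoubling.ddim_nonneg [Nonempty Ω] (h : IsDoubling Ω) : 0 ≤ ddim Ω := by
  obtain ⟨D, -, hpos, hD⟩ := h.exists_isDoublingConst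
  by_contra! hneg
  have h1 : (2 : ℝ) ^ ddim Ω < 1 := Real.rpow_lt_one_of_one_lt_of_neg one_lt_two hneg
  rw [hD] at h1
  have : (1 : ℝ) ≤ D := by exact_mod_cast hpos
  linarith

theorem IsDoublingConst.exists_cover {D : ℕ} (hD : IsDoublingConst Ω D) (x : Ω) {r : ℝ}
    (hr : 0 < r) (k : ℕ) : ∃ s : Finset Ω, s.card ≤ D ^ k ∧
      Metric.closedBall x r ⊆ ⋃ c ∈ s, Metric.closedBall c (r / 2 ^ k) := by
  classical
  induction k with
  | zero => exact ⟨{x}, by simp, by simp⟩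
  | succ k ih =>
    obtain ⟨s, hs, hcov⟩ := ih
    choose t ht htcov using fun c => hD c (r / 2 ^ k) (by positivity)
    refine ⟨s.biUnion t, ?_, fun z hz => ?_⟩
    · rw [pow_succ]
      exact (Finset.card_biUnion_le_card_mul s t D fun c _ => ht c).trans
        (Nat.mul_le_mul_right D hs)
    · obtain ⟨c, hc, hzc⟩ := mem_iUnion₂.1 (hcov hz)
      obtain ⟨e, he, hze⟩ := mem_iUnion₂.1 (htcov c hzc)
      refine mem_iUnion₂.2 ⟨e, Finset.mem_biUnion.2 ⟨c, hc, he⟩, ?_⟩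
      rwa [pow_succ, ← div_div]

/-- A partition into `N` measurable cells of diameter at most `δ`. -/
structure IsPartition [MeasurableSpace Ω] (δ : ℝ) {N : ℕ} (C : Fin N → Set Ω) : Prop where
  measurableSet : ∀ c, MeasurableSet (C c)
  disjoint : Pairwise (Function.onFun Disjoint C)
  iUnion_eq : ⋃ c, C c = univ
  dist_le : ∀ c, ∀ x ∈ C c, ∀ x' ∈ C c, dist x x' ≤ δ

/-- Making the balls disjoint in succession keeps their union and measurability and only shrinks
each one. -/
theorem exists_isPartition [MeasurableSpace Ω] [BorelSpace Ω] (s : Finset Ω) {r : ℝ}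
    (hs : univ ⊆ ⋃ c ∈ s, Metric.closedBall c r) :
    ∃ C : Fin s.card → Set Ω, IsPartition (2 * r) C := by
  classical
  let g : ℕ → Set Ω := fun i =>
    if h : i < s.card then Metric.closedBall (s.equivFin.symm ⟨i, h⟩ : Ω) r else ∅
  have hg : ∀ i, MeasurableSet (g i) := by
    intro i
    by_cases h : i < s.card
    · simp only [g, h, dif_pos]; exact measurableSet_closedBall
    · simp [g, h]
  refine ⟨fun c => disjointed g c, fun c => MeasurableSet.disjointed hg _, ?_, ?_, ?_⟩
  · intro a b hab
    exact disjoint_disjointed g (fun h => hab (Fin.ext h))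
  · refine eq_univ_of_univ_subset fun x hx => ?_
    have hxg : x ∈ ⋃ i, disjointed g i := by
      rw [iUnion_disjointed]
      obtain ⟨c, hc, hxc⟩ := mem_iUnion₂.1 (hs hx)
      refine mem_iUnion.2 ⟨(s.equivFin ⟨c, hc⟩ : Fin s.card), ?_⟩
      simpa [g] using hxc
    obtain ⟨i, hi⟩ := mem_iUnion.1 hxg
    have hlt : i < s.card := by
      by_contra h
      have := disjointed_subset g i hi
      simp [g, h] at this
    exact mem_iUnion.2 ⟨⟨i, hlt⟩, hi⟩
  · intro c x hx x' hx'
    have h1 := disjointed_subset g c hx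
    have h2 := disjointed_subset g c hx'
    simp only [g, c.2, dif_pos, Metric.mem_closedBall] at h1 h2
    linarith [dist_triangle_right x x' (s.equivFin.symm ⟨c, c.2⟩ : Ω)]

/-- A doubling space of diameter at most one has a partition into at most `(8 / ε) ^ ddim Ω` cells
of diameter at most `ε / 2`. -/
theorem IsDoubling.exists_isPartition [MeasurableSpace Ω] [BorelSpace Ω] [Nonempty Ω]
    (h : IsDoubling Ω) (hdiam : Metric.ediam (univ : Set Ω) ≤ 1) {ε : ℝ} (hε : 0 < ε)
    (hε1 : ε < 1) :
    ∃ (N : ℕ) (C : Fin N → Set Ω), (N : ℝ) ≤ (8 / ε) ^ ddim Ω ∧ IsPartition (ε / 2) C := by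
  obtain ⟨D, hD, hpos, hD2⟩ := h.exists_isDoublingConst
  have h8 : 1 ≤ 8 / ε := by rw [le_div_iff₀ hε]; linarith
  -- With 2^k ≤ 8/ε < 2^(k+1), the count D^k = (2^k)^d is at most (8/ε)^d, and balls of radius
  -- 2^(-k) have diameter at most 2·2^(-k) < ε/2.
  obtain ⟨k, hk1, hk2⟩ := exists_nat_pow_near h8 one_lt_two
  obtain ⟨x⟩ := ‹Nonempty Ω›
  obtain ⟨s, hs, hcov⟩ := hD.exists_cover x one_pos k
  have huniv : univ ⊆ ⋃ c ∈ s, Metric.closedBall c (1 / 2 ^ k) := by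
    refine fun z _ => hcov ?_
    rw [Metric.mem_closedBall, ← ENNReal.ofReal_le_ofReal_iff zero_le_one, ← edist_dist,
      ENNReal.ofReal_one]
    exact (Metric.edist_le_ediam_of_mem (mem_univ z) (mem_univ x)).trans hdiam
  obtain ⟨C, hC⟩ := AvgSlope.exists_isPartition s huniv
  refine ⟨s.card, C, ?_, hC.measurableSet, hC.disjoint, hC.iUnion_eq, fun c x hx x' hx' => ?_⟩
  · calc (s.card : ℝ) ≤ (D : ℝ) ^ k := by exact_mod_cast hs
      _ = ((2 : ℝ) ^ k) ^ ddim Ω := by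
        rw [← hD2, ← Real.rpow_natCast, ← Real.rpow_mul zero_le_two, mul_comm,
          Real.rpow_mul zero_le_two, Real.rpow_natCast]
      _ ≤ _ := Real.rpow_le_rpow (by positivity) hk1 h.ddim_nonneg
  · refine (hC.dist_le c x hx x' hx').trans ?_
    rw [pow_succ, div_lt_iff₀ hε] at hk2
    rw [mul_one_div, div_le_iff₀ (by positivity)]
    linarith

end Partition

/-! ### Lower tails of cell counts -/

section Chernoff

variable {Ω : Type u} [MeasurableSpace Ω]

/-- The number of sample points in `C`. -/
noncomputable def count {n : ℕ} (C : Set Ω) (X : Fin n → Ω) : ℝ :=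
  ∑ i, C.indicator (fun _ => (1 : ℝ)) (X i)

theorem measurable_count {n : ℕ} {C : Set Ω} (hC : MeasurableSet C) :
    Measurable (count C : (Fin n → Ω) → ℝ) :=
  Finset.measurable_sum _ fun i _ =>
    (measurable_const.indicator hC).comp (measurable_pi_apply i)

/-- Lower tail of the number of sample points in a set. -/
theorem measureReal_count_lt_le (μ : Measure Ω) [IsProbabilityMeasure μ] (n : ℕ) {C : Set Ω}
    (hC : MeasurableSet C) :
    (Measure.pi (fun _ : Fin n => μ)).real {X | 2 * count C X < n * μ.real C} ≤
      Real.exp (-(n * (3 / 20 * μ.real C))) := by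
  set p := μ.real C with hp
  have hp0 : 0 ≤ p := measureReal_nonneg
  -- This is 2 to the power -1_C, so its product over the sample is 2^(-count). Markov's inequality
  -- for the product is the Chernoff bound with parameter log 2.
  let g : Ω → ℝ := fun x => 1 - C.indicator (fun _ => (1 / 2 : ℝ)) x
  have hg : ∀ x, g x = Real.exp (-Real.log 2 * C.indicator (fun _ => (1 : ℝ)) x) := by
    intro x
    by_cases hx : x ∈ C
    · simp only [g, indicator_of_mem hx, mul_one, Real.exp_neg, Real.exp_log two_pos]; norm_num
    · simp [g, indicator_of_notMem hx]
  have hgm : Measurable g := measurable_const.sub (measurable_const.indicator hC)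
  have hg0 : ∀ x, 0 ≤ g x := fun x => by rw [hg]; positivity
  have hg1 : ∀ x, g x ≤ 1 := fun x => by
    have : 0 ≤ C.indicator (fun _ => (1 / 2 : ℝ)) x := indicator_nonneg (fun _ _ => by norm_num) x
    simp only [g]; linarith
  have hprod : ∀ X : Fin n → Ω, ∏ i, g (X i) = Real.exp (-Real.log 2 * count C X) := by
    intro X
    rw [count, Finset.mul_sum, Real.exp_sum]
    exact Finset.prod_congr rfl fun i _ => hg _
  have hint : ∫ x, g x ∂μ = 1 - p / 2 := by
    have hi : Integrable (C.indicator (fun _ => (1 / 2 : ℝ))) μ :=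
      (integrable_const _).indicator hC
    simp only [g]
    rw [integral_sub (integrable_const _) hi, integral_indicator_const _ hC]
    simp [← hp]; ring
  have hmark := mul_meas_ge_le_integral_of_nonneg (μ := Measure.pi (fun _ : Fin n => μ))
    (f := fun X => ∏ i, g (X i)) (Eventually.of_forall fun X => Finset.prod_nonneg fun i _ => hg0 _)
    (Integrable.of_bound (C := 1) (Finset.measurable_prod _ fun i _ =>
      hgm.comp (measurable_pi_apply i)).aestronglyMeasurable (Eventually.of_forall fun X => by
        rw [Real.norm_of_nonneg (Finset.prod_nonneg fun i _ => hg0 _)]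
        exact Finset.prod_le_one (fun i _ => hg0 _) fun i _ => hg1 _))
    (Real.exp (-Real.log 2 * (n * p / 2)))
  rw [integral_fintype_prod_eq_pow, hint, Fintype.card_fin] at hmark
  have hsub : {X : Fin n → Ω | 2 * count C X < n * p} ⊆
      {X | Real.exp (-Real.log 2 * (n * p / 2)) ≤ ∏ i, g (X i)} := by
    intro X hX
    have hX' : 2 * count C X < n * p := hX
    show Real.exp (-Real.log 2 * (n * p / 2)) ≤ ∏ i, g (X i)
    rw [hprod, Real.exp_le_exp]
    nlinarith [Real.log_pos one_lt_two]
  have hle := measureReal_mono (μ := Measure.pi (fun _ : Fin n => μ)) hsub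
  have hpow : (1 - p / 2) ^ n ≤ Real.exp (-(n * (p / 2))) := by
    have hp1 : p ≤ 1 := measureReal_le_one
    calc (1 - p / 2) ^ n ≤ Real.exp (-(p / 2)) ^ n := by
          refine pow_le_pow_left₀ (by linarith) ?_ n
          linarith [Real.add_one_le_exp (-(p / 2))]
      _ = _ := by rw [← Real.exp_nat_mul]; ring_nf
  have hfin : (Measure.pi (fun _ : Fin n => μ)).real {X | 2 * count C X < n * p} ≤
      Real.exp (-(n * (p / 2))) / Real.exp (-Real.log 2 * (n * p / 2)) := by
    rw [le_div_iff₀ (Real.exp_pos _), mul_comm]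
    exact (mul_le_mul_of_nonneg_left hle (Real.exp_pos _).le).trans (hmark.trans hpow)
  refine hfin.trans ?_
  rw [← Real.exp_sub, Real.exp_le_exp]
  have hnp : 0 ≤ n * p := by positivity
  -- The rate obtained is (1 - log 2)/2, which exceeds 3/20.
  nlinarith [Real.log_two_lt_d9]

/-- With high probability every cell of sufficient mass gets at least half its expected share of
the sample. -/
theorem one_sub_le_measureReal_count (μ : Measure Ω) [IsProbabilityMeasure μ] (n : ℕ) {N : ℕ}
    {C : Fin N → Set Ω} (hC : ∀ c, MeasurableSet (C c)) (H : Finset (Fin N)) {q : ℝ}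
    (hH : ∀ c ∈ H, 20 / 3 * q ≤ μ.real (C c)) :
    MeasurableSet {X : Fin n → Ω | ∀ c ∈ H, n * μ.real (C c) ≤ 2 * count (C c) X} ∧
    1 - N * Real.exp (-(n * q)) ≤ (Measure.pi (fun _ : Fin n => μ)).real
      {X | ∀ c ∈ H, n * μ.real (C c) ≤ 2 * count (C c) X} := by
  set G : Set (Fin n → Ω) := {X | ∀ c ∈ H, n * μ.real (C c) ≤ 2 * count (C c) X} with hG
  have hGc : Gᶜ = ⋃ c ∈ H, {X | 2 * count (C c) X < n * μ.real (C c)} := by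
    ext X
    simp [hG]
  have hGm : MeasurableSet G := by
    refine MeasurableSet.of_compl ?_
    rw [hGc]
    exact Finset.measurableSet_biUnion _ fun c _ =>
      measurableSet_lt ((measurable_count (hC c)).const_mul 2) measurable_const
  refine ⟨hGm, ?_⟩
  have h1 : (Measure.pi (fun _ : Fin n => μ)).real Gᶜ ≤ N * Real.exp (-(n * q)) := by
    rw [hGc]
    calc _ ≤ ∑ c ∈ H, (Measure.pi (fun _ : Fin n => μ)).real
            {X | 2 * count (C c) X < n * μ.real (C c)} := measureReal_biUnion_finset_le _ _
      _ ≤ ∑ c ∈ H, Real.exp (-(n * q)) := by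
          refine Finset.sum_le_sum fun c hc => (measureReal_count_lt_le μ n (hC c)).trans ?_
          rw [Real.exp_le_exp]
          have := mul_le_mul_of_nonneg_left (hH c hc) (Nat.cast_nonneg (α := ℝ) n)
          linarith
      _ ≤ _ := by
          rw [Finset.sum_const, nsmul_eq_mul]
          gcongr
          exact_mod_cast (Finset.card_le_univ H).trans (by simp)
  rw [probReal_compl_eq_one_sub hGm] at h1
  linarith

end Chernoff

/-! ### Average slope over the whole space -/

namespace TrimmedNet

variable {Ω : Type u} [MetricSpace Ω] {n : ℕ} {ε : ℝ} {X : Fin n → Ω} {y f : Ω → ℝ}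
  {T : Finset (Fin n)} {V : Set Ω}

/-- For u ≠ v in the net the denominator of R_x(u, v) is at least ρ(u,v) > ε. Moving x by at most
ε/2 adds at most ε to it, so it at most doubles. -/
theorem pmseRStar_le_two_mul (h : TrimmedNet ε X y f T V) (hε : 0 < ε) (hne : V.Nonempty)
    {x x' : Ω} (hxx' : dist x x' ≤ ε / 2) : pmseRStar V y x ≤ 2 * pmseRStar V y x' := by
  obtain ⟨u, v, hm⟩ := exists_isMaxPair h.finite hne y x
  rw [hm.pmseRStar_eq]
  rcases eq_or_ne u v with rfl | huv
  · have : pmseR y x u u = 0 := by simp [pmseR]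
    rw [this]
    linarith [pmseRStar_nonneg (y := y) h.finite hne x']
  · have hsep := h.separated u hm.1 v hm.2.1 huv
    have htri := dist_triangle_left u v x
    have htri' := dist_triangle_left u v x'
    have h0 : 0 ≤ y v - y u := by
      have := hm.nonneg
      rw [pmseR, div_nonneg_iff] at this
      rcases this with h1 | h1
      · exact h1.1
      · linarith [h1.2]
    have hle := pmseR_le_pmseRStar (y := y) h.finite hne hm.1 hm.2.1 (x := x')
    have du : dist x' u ≤ dist x x' + dist x u := by
      rw [dist_comm x x']; exact dist_triangle _ _ _
    have dv : dist x' v ≤ dist x x' + dist x v := by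
      rw [dist_comm x x']; exact dist_triangle _ _ _
    calc pmseR y x u v ≤ 2 * pmseR y x' u v := by
          rw [pmseR, pmseR, ← mul_div_assoc, div_le_div_iff₀ (by linarith) (by linarith)]
          nlinarith
      _ ≤ _ := by gcongr

/-- As ρ(x,u) + ρ(x,v) ≥ ρ(u,v), R_x(u, v) is at most the slope of y at v. The point v is untrimmed,
so each trimmed point has at least that slope. -/
theorem card_mul_pmseRStar_le (h : TrimmedNet ε X y f T V) (hne : V.Nonempty)
    (x : Ω) : (T.card : ℝ≥0∞) * ENNReal.ofReal (pmseRStar V y x) ≤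
      ∑ i, slope y (X i) (range X) := by
  obtain ⟨u, v, hm⟩ := exists_isMaxPair h.finite hne y x
  rw [hm.pmseRStar_eq]
  rcases eq_or_ne u v with rfl | huv
  · simp [pmseR]
  · obtain ⟨j, hj, rfl⟩ := h.exists_eq v hm.2.1
    have hpos : 0 < dist (X j) u := dist_pos.2 huv.symm
    have hle : ENNReal.ofReal (pmseR y x u (X j)) ≤ slope y (X j) (range X) := by
      refine le_trans (ENNReal.ofReal_le_ofReal ?_) (le_iSup₂ (f := fun x' (_ : x' ∈ range X \ {X j})
        => ENNReal.ofReal (|y (X j) - y x'| / dist (X j) x')) u ⟨h.subset_range hm.1, huv⟩)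
      rw [pmseR]
      exact div_le_div₀ (abs_nonneg _) (le_abs_self _) hpos (dist_triangle_left _ _ _)
    calc (T.card : ℝ≥0∞) * ENNReal.ofReal (pmseR y x u (X j))
        ≤ T.card * slope y (X j) (range X) := by gcongr
      _ = ∑ i ∈ T, slope y (X j) (range X) := by simp
      _ ≤ ∑ i ∈ T, slope y (X i) (range X) :=
          Finset.sum_le_sum fun i hi => h.slope_le i hi j hj
      _ ≤ _ := Finset.sum_le_sum_of_subset (Finset.subset_univ _)

variable [MeasurableSpace Ω]

/-- Each sample point in C bounds the integral over C by 2μ(C) times its slope. Summing over the at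
least nμ(C)/2 sample points in C and cancelling μ(C) gives the factor 4. -/
theorem lintegral_cell_le (h : TrimmedNet ε X y f T V) (hε : 0 < ε) (hne : V.Nonempty)
    (μ : Measure Ω) [IsFiniteMeasure μ] {C : Set Ω} (hC : MeasurableSet C)
    (hdist : ∀ x ∈ C, ∀ x' ∈ C, dist x x' ≤ ε / 2) (hcount : n * μ.real C ≤ 2 * count C X) :
    n * ∫⁻ x in C, ENNReal.ofReal (pmseRStar V y x) ∂μ ≤
      4 * ∑ i, C.indicator (fun x => slope y x (range X)) (X i) := by
  classical
  set I := ∫⁻ x in C, ENNReal.ofReal (pmseRStar V y x) ∂μ with hI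
  rcases eq_or_ne (μ C) 0 with h0 | h0
  · have : I = 0 := by rw [hI, Measure.restrict_eq_zero.2 h0, lintegral_zero_measure]
    rw [this]; simp
  have hcell : ∀ i, C.indicator (fun _ => (1 : ℝ≥0∞)) (X i) * I ≤
      2 * μ C * C.indicator (fun x => slope y x (range X)) (X i) := by
    intro i
    by_cases hi : X i ∈ C
    · simp only [indicator_of_mem hi, one_mul]
      calc I ≤ ∫⁻ _ in C, 2 * slope y (X i) (range X) ∂μ := by
            refine setLIntegral_mono' hC fun x hx => ?_
            calc ENNReal.ofReal (pmseRStar V y x)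
                ≤ ENNReal.ofReal (2 * pmseRStar V y (X i)) := ENNReal.ofReal_le_ofReal
                  (h.pmseRStar_le_two_mul hε hne (hdist x hx _ hi))
              _ = 2 * ENNReal.ofReal (pmseRStar V y (X i)) := by
                  rw [ENNReal.ofReal_mul zero_le_two, ENNReal.ofReal_ofNat]
              _ ≤ _ := by
                  gcongr
                  exact ofReal_pmseRStar_le_slope h.finite hne h.subset_range y _
        _ = _ := by rw [setLIntegral_const]; ring
    · simp [indicator_of_notMem hi]
  have hcount' : (n : ℝ≥0∞) * μ C ≤ 2 * ∑ i, C.indicator (fun _ => (1 : ℝ≥0∞)) (X i) := by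
    have h1 : ENNReal.ofReal (n * μ.real C) = n * μ C := by
      rw [ENNReal.ofReal_mul (Nat.cast_nonneg n), ENNReal.ofReal_natCast, ofReal_measureReal]
    have h2 : ENNReal.ofReal (2 * count C X) =
        2 * ∑ i, C.indicator (fun _ => (1 : ℝ≥0∞)) (X i) := by
      rw [ENNReal.ofReal_mul zero_le_two, ENNReal.ofReal_ofNat, count,
        ENNReal.ofReal_sum_of_nonneg fun i _ => indicator_nonneg (fun _ _ => zero_le_one) _]
      congr 1
      refine Finset.sum_congr rfl fun i _ => ?_
      by_cases hi : X i ∈ C <;> simp [hi]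
    rw [← h1, ← h2]
    exact ENNReal.ofReal_le_ofReal hcount
  refine (ENNReal.mul_le_mul_iff_right h0 (measure_ne_top μ C)).1 ?_
  calc μ C * (n * I) = (n * μ C) * I := by ring
    _ ≤ 2 * (∑ i, C.indicator (fun _ => (1 : ℝ≥0∞)) (X i)) * I := by gcongr
    _ = 2 * ∑ i, C.indicator (fun _ => (1 : ℝ≥0∞)) (X i) * I := by
        rw [mul_assoc, Finset.sum_mul]
    _ ≤ 2 * ∑ i, 2 * μ C * C.indicator (fun x => slope y x (range X)) (X i) := by
        exact mul_le_mul' le_rfl (Finset.sum_le_sum fun i _ => hcell i)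
    _ = _ := by rw [← Finset.mul_sum]; ring

theorem strongSlope_univ_le [BorelSpace Ω] (h : TrimmedNet ε X y f T V) (hε : 0 < ε)
    (hε1 : ε < 1) (hn : 6 ≤ ε * n) (μ : Measure Ω) [IsFiniteMeasure μ] {N : ℕ}
    {C : Fin N → Set Ω} (hC : IsPartition (ε / 2) C) (H : Finset (Fin N))
    (hH : ∀ c ∈ H, n * μ.real (C c) ≤ 2 * count (C c) X)
    (hL : ∑ c ∈ Hᶜ, μ.real (C c) ≤ 5 / 6 * ε) :
    strongSlope f μ univ ≤ 5 * strongSlope y (empirical X) (range X) := by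
  have hn' : 0 < n := by
    rcases Nat.eq_zero_or_pos n with rfl | h'
    · norm_num at hn
    · exact h'
  have hne := h.nonempty hε hε1 hn'
  have hn0 : (n : ℝ≥0∞) ≠ 0 := by exact_mod_cast hn'.ne'
  have hnt : (n : ℝ≥0∞) ≠ ⊤ := ENNReal.natCast_ne_top n
  rw [strongSlope, strongSlope, lintegral_empirical]
  simp only [h.isPMSE.slope_univ_eq h.finite hne]
  set S := ∑ i, slope y (X i) (range X) with hS
  have hsplit : ∫⁻ x, ENNReal.ofReal (pmseRStar V y x) ∂μ =
      ∑ c, ∫⁻ x in C c, ENNReal.ofReal (pmseRStar V y x) ∂μ := by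
    rw [← setLIntegral_univ, ← hC.iUnion_eq, lintegral_iUnion hC.measurableSet hC.disjoint,
      tsum_fintype]
  have hheavy : n * ∑ c ∈ H, ∫⁻ x in C c, ENNReal.ofReal (pmseRStar V y x) ∂μ ≤ 4 * S := by
    rw [Finset.mul_sum]
    calc _ ≤ ∑ c ∈ H, 4 * ∑ i, (C c).indicator (fun x => slope y x (range X)) (X i) :=
          Finset.sum_le_sum fun c hc => h.lintegral_cell_le hε hne μ (hC.measurableSet c)
            (hC.dist_le c) (hH c hc)
      _ = 4 * ∑ i, ∑ c ∈ H, (C c).indicator (fun x => slope y x (range X)) (X i) := by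
          rw [← Finset.mul_sum, Finset.sum_comm]
      _ ≤ 4 * S := by
          rw [hS]
          gcongr with i _
          -- A sample point lies in exactly one cell, so its slope is counted at most once.
          obtain ⟨c, hc⟩ := mem_iUnion.1 (hC.iUnion_eq.symm ▸ mem_univ (X i))
          calc _ ≤ ∑ c, (C c).indicator (fun x => slope y x (range X)) (X i) :=
                Finset.sum_le_sum_of_subset (Finset.subset_univ _)
            _ = (C c).indicator (fun x => slope y x (range X)) (X i) := by
                refine Finset.sum_eq_single c (fun b _ hb => ?_) (by simp)
                exact indicator_of_notMem (disjoint_right.1 (hC.disjoint hb) hc) _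
            _ = _ := indicator_of_mem hc _
  -- Rounding down loses less than 1, which is at most a sixth of εn ≥ 6.
  have hfloor : 5 / 6 * ε * n ≤ (T.card : ℝ) := by
    rw [h.card_eq]
    have := (Nat.lt_floor_add_one (ε * n)).le
    linarith
  have hmax : ∀ x, ENNReal.ofReal (5 / 6 * ε) * n * ENNReal.ofReal (pmseRStar V y x) ≤ S := by
    intro x
    refine le_trans ?_ (h.card_mul_pmseRStar_le hne x)
    gcongr
    rw [← ENNReal.ofReal_natCast n, ← ENNReal.ofReal_natCast T.card,
      ← ENNReal.ofReal_mul (by positivity)]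
    exact ENNReal.ofReal_le_ofReal hfloor
  -- The light mass 5ε/6 cancels against the uniform bound R* ≤ S / (5εn/6).
  have hlight : n * ∑ c ∈ Hᶜ, ∫⁻ x in C c, ENNReal.ofReal (pmseRStar V y x) ∂μ ≤ S := by
    have hc0 : ENNReal.ofReal (5 / 6 * ε) ≠ 0 := by
      rw [Ne, ENNReal.ofReal_eq_zero]; linarith
    refine (ENNReal.mul_le_mul_iff_right hc0 ENNReal.ofReal_ne_top).1 ?_
    calc ENNReal.ofReal (5 / 6 * ε) *
          (n * ∑ c ∈ Hᶜ, ∫⁻ x in C c, ENNReal.ofReal (pmseRStar V y x) ∂μ)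
        = ∑ c ∈ Hᶜ, ∫⁻ x in C c,
            ENNReal.ofReal (5 / 6 * ε) * n * ENNReal.ofReal (pmseRStar V y x) ∂μ := by
          rw [← mul_assoc, Finset.mul_sum]
          refine Finset.sum_congr rfl fun c _ => ?_
          rw [lintegral_const_mul' _ _ (ENNReal.mul_ne_top ENNReal.ofReal_ne_top hnt)]
      _ ≤ ∑ c ∈ Hᶜ, ∫⁻ _ in C c, S ∂μ :=
          Finset.sum_le_sum fun c _ => lintegral_mono fun x => hmax x
      _ = (∑ c ∈ Hᶜ, μ (C c)) * S := by
          simp only [setLIntegral_const]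
          rw [← Finset.mul_sum, mul_comm]
      _ ≤ _ := by
          gcongr
          calc ∑ c ∈ Hᶜ, μ (C c) = ENNReal.ofReal (∑ c ∈ Hᶜ, μ.real (C c)) := by
                rw [ENNReal.ofReal_sum_of_nonneg fun c _ => measureReal_nonneg]
                exact Finset.sum_congr rfl fun c _ => (ofReal_measureReal (s := C c) (μ := μ)).symm
            _ ≤ _ := ENNReal.ofReal_le_ofReal hL
  refine (ENNReal.mul_le_mul_iff_right hn0 hnt).1 ?_
  calc n * ∫⁻ x, ENNReal.ofReal (pmseRStar V y x) ∂μ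
      = n * (∑ c ∈ H, ∫⁻ x in C c, ENNReal.ofReal (pmseRStar V y x) ∂μ) +
        n * ∑ c ∈ Hᶜ, ∫⁻ x in C c, ENNReal.ofReal (pmseRStar V y x) ∂μ := by
        rw [hsplit, ← mul_add, Finset.sum_add_sum_compl]
    _ ≤ 4 * S + S := add_le_add hheavy hlight
    _ = 5 * (n * (n : ℝ≥0∞)⁻¹) * S := by
        rw [ENNReal.mul_inv_cancel hn0 hnt]; ring
    _ = _ := by ring

end TrimmedNet

/-- The event is fixed by the counts in the heavy cells before labels, ties or net are chosen; this
is what makes the bound uniform. -/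
theorem exists_measurableSet_strongSlope_le {Ω : Type u} [MetricSpace Ω] [MeasurableSpace Ω]
    [BorelSpace Ω] (μ : Measure Ω) [IsProbabilityMeasure μ] {ε : ℝ} {n : ℕ}
    (hdiam : Metric.ediam (univ : Set Ω) ≤ 1) (hdoub : IsDoubling Ω) (hε : 0 < ε) (hε1 : ε < 1)
    (hn : 6 ≤ ε * n) :
    ∃ G : Set (Fin n → Ω), MeasurableSet G ∧
      1 - Real.exp (-(n : ℝ) * (ε / 8) ^ (ddim Ω + 1) + ddim Ω * Real.log (8 / ε))
        ≤ (Measure.pi (fun _ : Fin n => μ)).real G ∧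
      ∀ X ∈ G, ∀ y f : Ω → ℝ, IsTrimmedNetPMSE ε X y f →
        strongSlope f μ univ ≤ 5 * strongSlope y (empirical X) (range X) := by
  classical
  have : Nonempty Ω := nonempty_of_isProbabilityMeasure μ
  obtain ⟨N, C, hN, hC⟩ := hdoub.exists_isPartition hdiam hε hε1
  set q := (ε / 8) ^ (ddim Ω + 1) with hq
  have hq0 : 0 < q := by positivity
  -- The factor 20/3 offsets the Chernoff rate 3/20, leaving exp(-nq) per cell. It also keeps the
  -- light mass at most (8/ε)^d · (20/3)(ε/8)^(d+1) = 5ε/6.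
  let H : Finset (Fin N) := Finset.univ.filter fun c => 20 / 3 * q ≤ μ.real (C c)
  obtain ⟨hGm, hG⟩ := one_sub_le_measureReal_count μ n hC.measurableSet H (q := q)
    fun c hc => (Finset.mem_filter.1 hc).2
  refine ⟨_, hGm, le_trans ?_ hG, fun X hX y f hf => ?_⟩
  · have : Real.exp (-(n : ℝ) * q + ddim Ω * Real.log (8 / ε)) =
        (8 / ε) ^ ddim Ω * Real.exp (-(n * q)) := by
      rw [Real.exp_add, Real.rpow_def_of_pos (by positivity), mul_comm (ddim Ω), mul_comm, neg_mul]
    rw [this]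
    gcongr
  · obtain ⟨T, V, h⟩ := (isTrimmedNetPMSE_iff hε).1 hf
    refine h.strongSlope_univ_le hε hε1 hn μ hC H hX ?_
    calc ∑ c ∈ Hᶜ, μ.real (C c) ≤ ∑ c ∈ Hᶜ, 20 / 3 * q := by
          refine Finset.sum_le_sum fun c hc => ?_
          simp only [H, Finset.mem_compl, Finset.mem_filter, Finset.mem_univ, true_and,
            not_le] at hc
          exact hc.le
      _ ≤ N * (20 / 3 * q) := by
          rw [Finset.sum_const, nsmul_eq_mul]
          gcongr
          exact_mod_cast (Finset.card_le_univ Hᶜ).trans (by simp)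
      _ ≤ (8 / ε) ^ ddim Ω * (20 / 3 * q) := by gcongr
      _ = 20 / 3 * (((8 / ε) * (ε / 8)) ^ ddim Ω * (ε / 8)) := by
          rw [hq, Real.rpow_add_one (by positivity), Real.mul_rpow (by positivity) (by positivity)]
          ring
      _ = 5 / 6 * ε := by
          rw [show 8 / ε * (ε / 8) = 1 by field_simp, Real.one_rpow]
          ring

/-! ### Hoare logic with step counts -/

namespace Prog

/-- A bound on the number of steps of a program all of whose loops are run at most `n` times. -/
def maxCost (n : ℕ) : Prog → ℕ
  | skip => 1
  | reset _ => 1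
  | incr _ => 1
  | copy _ _ => 1
  | set _ _ e => e.cost + 1
  | seq p q => maxCost n p + maxCost n q
  | ifReal e₁ e₂ p q => e₁.cost + e₂.cost + 1 + max (maxCost n p) (maxCost n q)
  | ifIdx _ _ p q => 1 + max (maxCost n p) (maxCost n q)
  | loop _ p => 1 + n * (maxCost n p + 1)

/-- Hoare triples: started in a memory with `P`, the program `p` ends in one with `Q`, within
`p.maxCost n` steps. -/
def Triple (o : Oracle) (n : ℕ) (P : Mem → Prop) (p : Prog) (Q : Mem → Prop) : Prop :=
  ∀ m t, P m → Q (p.run o (m, t)).1 ∧ (p.run o (m, t)).2 ≤ t + p.maxCost n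

/-- The weakest precondition of loop-free programs. -/
def wp (o : Oracle) : Prog → (Mem → Prop) → Mem → Prop
  | skip, Q, m => Q m
  | reset k, Q, m => Q ⟨Function.update m.idx k 0, m.arr⟩
  | incr k, Q, m => Q ⟨Function.update m.idx k (m.idx k + 1), m.arr⟩
  | copy k l, Q, m => Q ⟨Function.update m.idx k (m.idx l), m.arr⟩
  | set a k e, Q, m =>
      Q ⟨m.idx, Function.update m.arr a (Function.update (m.arr a) (m.idx k) (e.val o m))⟩
  | seq p q, Q, m => wp o p (wp o q Q) m
  | ifReal e₁ e₂ p q, Q, m =>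
      (e₁.val o m < e₂.val o m → wp o p Q m) ∧ (e₂.val o m ≤ e₁.val o m → wp o q Q m)
  | ifIdx k l p q, Q, m =>
      (m.idx k < m.idx l → wp o p Q m) ∧ (m.idx l ≤ m.idx k → wp o q Q m)
  | loop _ _, _, _ => False

variable {o : Oracle} {n : ℕ} {P Q R : Mem → Prop} {p q : Prog}

/-- Structural induction; loops are vacuous here, their precondition being `False`, and are left to
`Triple.loop`. -/
theorem triple_wp (p : Prog) : ∀ Q, Triple o n (wp o p Q) p Q := by
  induction p with
  | skip => exact fun Q m t h => ⟨h, le_rfl⟩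
  | reset k => exact fun Q m t h => ⟨h, le_rfl⟩
  | incr k => exact fun Q m t h => ⟨h, le_rfl⟩
  | copy k l => exact fun Q m t h => ⟨h, le_rfl⟩
  | set a k e => exact fun Q m t h => ⟨h, by simp [run, maxCost, add_assoc]⟩
  | seq p q ihp ihq =>
    intro Q m t h
    obtain ⟨h1, h2⟩ := ihp _ m t h
    obtain ⟨h3, h4⟩ := ihq Q _ (run o p (m, t)).2 h1
    refine ⟨h3, h4.trans ?_⟩
    simp only [maxCost]; omega
  | ifReal e₁ e₂ p q ihp ihq =>
    intro Q m t h
    simp only [run, maxCost]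
    split_ifs with hc
    · obtain ⟨h1, h2⟩ := ihp Q m (t + e₁.cost + e₂.cost + 1) (h.1 hc)
      exact ⟨h1, by omega⟩
    · obtain ⟨h1, h2⟩ := ihq Q m (t + e₁.cost + e₂.cost + 1) (h.2 (not_lt.1 hc))
      exact ⟨h1, by omega⟩
  | ifIdx k l p q ihp ihq =>
    intro Q m t h
    simp only [run, maxCost]
    split_ifs with hc
    · obtain ⟨h1, h2⟩ := ihp Q m (t + 1) (h.1 hc)
      exact ⟨h1, by omega⟩
    · obtain ⟨h1, h2⟩ := ihq Q m (t + 1) (h.2 (not_lt.1 hc))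
      exact ⟨h1, by omega⟩
  | loop k p _ => exact fun Q m t h => h.elim

theorem Triple.of_wp (h : ∀ m, P m → wp o p Q m) : Triple o n P p Q :=
  fun m t hP => triple_wp p Q m t (h m hP)

theorem Triple.seq (hp : Triple o n P p Q) (hq : Triple o n Q q R) :
    Triple o n P (p.seq q) R := by
  intro m t h
  obtain ⟨h1, h2⟩ := hp m t h
  obtain ⟨h3, h4⟩ := hq _ (run o p (m, t)).2 h1
  refine ⟨h3, h4.trans ?_⟩
  simp only [maxCost]; omega

theorem Triple.ifReal {e₁ e₂ : RExp}
    (hp : Triple o n (fun m => P m ∧ e₁.val o m < e₂.val o m) p Q)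
    (hq : Triple o n (fun m => P m ∧ e₂.val o m ≤ e₁.val o m) q Q) :
    Triple o n P (Prog.ifReal e₁ e₂ p q) Q := by
  intro m t h
  simp only [run, maxCost]
  split_ifs with hc
  · obtain ⟨h1, h2⟩ := hp m (t + e₁.cost + e₂.cost + 1) ⟨h, hc⟩
    exact ⟨h1, by omega⟩
  · obtain ⟨h1, h2⟩ := hq m (t + e₁.cost + e₂.cost + 1) ⟨h, not_lt.1 hc⟩
    exact ⟨h1, by omega⟩

theorem Triple.conseq {P' Q' : Mem → Prop} (h : Triple o n P p Q) (hP : ∀ m, P' m → P m)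
    (hQ : ∀ m, Q m → Q' m) : Triple o n P' p Q' := fun m t hm =>
  let ⟨h1, h2⟩ := h m t (hP m hm)
  ⟨hQ _ h1, h2⟩

/-- The rule for loops, with an invariant that may depend on the number of rounds done. -/
theorem Triple.loop {k : ℕ} (I : ℕ → Mem → Prop) (hk : ∀ m, I 0 m → m.idx k = n)
    (hp : ∀ i < n, Triple o n (I i) p (I (i + 1))) : Triple o n (I 0) (Prog.loop k p) (I n) := by
  intro m t h
  have key : ∀ i ≤ n, I i ((fun s : Mem × ℕ => run o p (s.1, s.2 + 1))^[i] (m, t + 1)).1 ∧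
      ((fun s : Mem × ℕ => run o p (s.1, s.2 + 1))^[i] (m, t + 1)).2 ≤
        t + 1 + i * (p.maxCost n + 1) := by
    intro i
    induction i with
    | zero => exact fun _ => ⟨h, by simp⟩
    | succ i ih =>
      intro hi
      obtain ⟨h1, h2⟩ := ih (by omega)
      rw [Function.iterate_succ_apply']
      set s := (fun s : Mem × ℕ => run o p (s.1, s.2 + 1))^[i] (m, t + 1)
      obtain ⟨h3, h4⟩ := hp i (by omega) s.1 (s.2 + 1) h1
      refine ⟨h3, h4.trans ?_⟩
      rw [add_mul]; omega
  have := key n le_rfl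
  simp only [run, maxCost, hk m h]
  exact ⟨this.1, this.2.trans (by omega)⟩

end Prog

/-! ### The programs and their specifications -/

section Programs

/-! ### Slopes of the sample points -/

/-- One round of the computation of the slope at point `i` (register 1), with the point `j`
(register 2). -/
def slopeStep : Prog :=
  .seq (.ifReal (.get 2 1) (.div (.sub (.get 1 1) (.get 1 2)) (.samp 1 2))
    (.set 2 1 (.div (.sub (.get 1 1) (.get 1 2)) (.samp 1 2))) .skip) <|
  .seq (.ifReal (.get 2 1) (.div (.sub (.get 1 2) (.get 1 1)) (.samp 1 2))
    (.set 2 1 (.div (.sub (.get 1 2) (.get 1 1)) (.samp 1 2))) .skip) <|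
  .incr 2

def slopeProg : Prog :=
  .seq (.reset 1) (.loop 0 (.seq (.reset 2) (.seq (.loop 0 slopeStep) (.incr 1))))

/-- The largest slope between point `i` and one of the first `j` points. -/
noncomputable def maxSlope (Y : ℕ → ℝ) (d : ℕ → ℕ → ℝ) (i : ℕ) : ℕ → ℝ
  | 0 => 0
  | j + 1 => max (max (maxSlope Y d i j) ((Y i - Y j) / d i j)) ((Y j - Y i) / d i j)

/-- The registers and arrays that no part of the preprocessing changes. -/
structure Base (n : ℕ) (ε : ℝ) (Y : ℕ → ℝ) (m : Mem) : Prop where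
  idx0 : m.idx 0 = n
  idx9 : m.idx 9 = 0
  eps : m.arr 0 0 = ε
  labels : m.arr 1 = Y

/-- Array 3 will flag the trimmed points, array 4 accumulate εn, array 7 flag the net. In `Base`,
register 9 is a constant 0 that addresses cell 0 of arrays used as scalars. -/
structure Blank (m : Mem) : Prop where
  arr3 : m.arr 3 = fun _ => 0
  arr4 : m.arr 4 0 = 0
  arr7 : m.arr 7 = fun _ => 0

open Prog

variable {n : ℕ} {ε : ℝ} {Y : ℕ → ℝ} {o : Oracle}

theorem slopeStep_spec {A : ℕ → ℝ} {i j : ℕ} :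
    Triple o n (fun m => (Base n ε Y m ∧ Blank m) ∧ m.idx 1 = i ∧ m.idx 2 = j ∧
      m.arr 2 = Function.update A i (maxSlope Y o.samp i j)) slopeStep
      (fun m => (Base n ε Y m ∧ Blank m) ∧ m.idx 1 = i ∧ m.idx 2 = j + 1 ∧
      m.arr 2 = Function.update A i (maxSlope Y o.samp i (j + 1))) := by
  refine .of_wp ?_
  rintro ⟨idx, arr⟩ ⟨⟨⟨h0, h9, he, hl⟩, ⟨h3, h4, h7⟩⟩, h1, h2, ha⟩
  simp only at h0 h9 he hl h3 h4 h7 h1 h2 ha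
  have hY : ∀ k, arr 1 k = Y k := fun k => congrFun hl k
  -- The two comparisons leave four cases that differ only in the value written to cell i; the frame
  -- conditions are settled once for all of them.
  have key : ∀ v, v = maxSlope Y o.samp i (j + 1) →
      (Base n ε Y ⟨Function.update idx 2 (j + 1), Function.update arr 2 (Function.update A i v)⟩ ∧
        Blank ⟨Function.update idx 2 (j + 1), Function.update arr 2 (Function.update A i v)⟩) ∧
      Function.update A i v = Function.update A i (maxSlope Y o.samp i (j + 1)) := by
    rintro v rfl
    exact ⟨⟨⟨by simpa, by simpa, by simpa, by simpa⟩, ⟨by simpa, by simpa, by simpa⟩⟩, rfl⟩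
  simp only [maxSlope] at key ⊢
  have hself : arr = Function.update arr 2 (Function.update A i (maxSlope Y o.samp i j)) := by
    rw [← ha, Function.update_eq_self]
  refine ⟨fun c1 => ⟨fun c2 => ?_, fun c2 => ?_⟩, fun c1 => ⟨fun c2 => ?_, fun c2 => ?_⟩⟩
  all_goals
    simp [wp, RExp.val, h1, h2, ha, hY] at c1 c2 ⊢
  · obtain ⟨h, h'⟩ := key ((Y j - Y i) / o.samp i j) (by
      rw [max_eq_right c1.le, max_eq_right c2.le])
    exact ⟨h, h'⟩
  · obtain ⟨h, h'⟩ := key ((Y i - Y j) / o.samp i j) (by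
      rw [max_eq_right c1.le, max_eq_left c2])
    exact ⟨h, h'⟩
  · obtain ⟨h, h'⟩ := key ((Y j - Y i) / o.samp i j) (by
      rw [max_eq_left c1, max_eq_right c2.le])
    exact ⟨h, h'⟩
  · obtain ⟨h, h'⟩ := key (maxSlope Y o.samp i j) (by
      rw [max_eq_left c1, max_eq_left c2])
    rw [← hself] at h
    exact ⟨h, h'⟩

theorem slopeProg_spec : Triple o n (fun m => (Base n ε Y m ∧ Blank m) ∧ m.arr 2 = fun _ => 0)
    slopeProg (fun m => (Base n ε Y m ∧ Blank m) ∧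
      m.arr 2 = fun k => if k < n then maxSlope Y o.samp k n else 0) := by
  let A : ℕ → ℕ → ℝ := fun i k => if k < i then maxSlope Y o.samp k n else 0
  have hloop : Triple o n
      (fun m => (Base n ε Y m ∧ Blank m) ∧ m.idx 1 = 0 ∧ m.arr 2 = A 0) _
      (fun m => (Base n ε Y m ∧ Blank m) ∧ m.idx 1 = n ∧ m.arr 2 = A n) :=
    Triple.loop (k := 0) (p := .seq (.reset 2) (.seq (.loop 0 slopeStep) (.incr 1)))
      (fun i m => (Base n ε Y m ∧ Blank m) ∧ m.idx 1 = i ∧ m.arr 2 = A i)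
      (fun m h => h.1.1.idx0) fun i _ => by
        refine Triple.seq (Q := fun m => (Base n ε Y m ∧ Blank m) ∧ m.idx 1 = i ∧ m.idx 2 = 0 ∧
          m.arr 2 = Function.update (A i) i (maxSlope Y o.samp i 0)) ?_ <|
          Triple.seq (Triple.loop (fun j m => (Base n ε Y m ∧ Blank m) ∧ m.idx 1 = i ∧
            m.idx 2 = j ∧ m.arr 2 = Function.update (A i) i (maxSlope Y o.samp i j))
            (fun m h => h.1.1.idx0) fun j _ => slopeStep_spec) ?_
        · refine .of_wp ?_
          rintro ⟨idx, arr⟩ ⟨⟨⟨h0, h9, he, hl⟩, ⟨h3, h4, h7⟩⟩, h1, ha⟩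
          refine ⟨⟨⟨by simpa [wp], by simpa [wp], he, hl⟩, ⟨h3, h4, h7⟩⟩, by simpa [wp],
            by simp, ?_⟩
          rw [eq_comm, Function.update_eq_iff]
          simp only at ha ⊢
          rw [ha]
          simp [A, maxSlope]
        · refine .of_wp ?_
          rintro ⟨idx, arr⟩ ⟨⟨⟨h0, h9, he, hl⟩, ⟨h3, h4, h7⟩⟩, h1, h2, ha⟩
          simp only at h1
          refine ⟨⟨⟨by simpa [wp], by simpa [wp], he, hl⟩, ⟨h3, h4, h7⟩⟩, by simp [h1], ?_⟩
          simp only at ha ⊢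
          rw [ha]
          ext k
          rcases lt_trichotomy k i with hk | rfl | hk
          · simp [A, hk.ne, hk, hk.trans (Nat.lt_succ_self i)]
          · simp [A]
          · simp [A, hk.ne', hk.not_gt, show ¬ k < i + 1 by omega]
  refine Triple.seq (Q := fun m => (Base n ε Y m ∧ Blank m) ∧ m.idx 1 = 0 ∧ m.arr 2 = A 0) ?_ <|
    hloop.conseq (fun m h => h) fun m h => ⟨h.1, h.2.2⟩
  refine .of_wp ?_
  rintro ⟨idx, arr⟩ ⟨⟨⟨h0, h9, he, hl⟩, ⟨h3, h4, h7⟩⟩, ha⟩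
  exact ⟨⟨⟨by simpa [wp], by simpa [wp], he, hl⟩, ⟨h3, h4, h7⟩⟩, by simp, by simpa [A] using ha⟩

/-! ### Trimming -/

/-- One round of the search for an untrimmed point with the largest slope. -/
def argmaxStep : Prog :=
  .seq (.ifReal (.get 3 1) .one
    (.ifReal (.get 6 9) (.get 2 1) (.seq (.set 6 9 (.get 2 1)) (.copy 3 1)) .skip) .skip)
    (.incr 1)

/-- The sentinel -1 lies below every slope, so the first untrimmed point always replaces it. -/
def argmaxProg : Prog :=
  .seq (.seq (.set 6 9 (.sub .zero .one)) (.reset 1)) (.loop 0 argmaxStep)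

def trimStep : Prog :=
  .seq (.ifReal (.get 4 9) (.get 5 9) .skip (.seq argmaxProg (.set 3 3 .one)))
    (.set 5 9 (.add (.get 5 9) .one))

/-- An index cannot be converted to a real, so εn is formed by n additions and rounds are counted by
a real in array 5, starting at 1. The trimming loop makes n rounds, idle once the counter exceeds
εn. -/
def trimProg : Prog :=
  .seq (.loop 0 (.set 4 9 (.add (.get 4 9) (.get 0 9)))) <|
  .seq (.set 5 9 .one) (.loop 0 trimStep)

/-- The indicator of a set of indices, as the content of an array of flags. -/
noncomputable def flags (T : Finset ℕ) (i : ℕ) : ℝ := if i ∈ T then 1 else 0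

theorem flags_lt_one {T : Finset ℕ} {i : ℕ} : flags T i < 1 ↔ i ∉ T := by
  by_cases h : i ∈ T <;> simp [flags, h]

theorem one_le_flags {T : Finset ℕ} {i : ℕ} : 1 ≤ flags T i ↔ i ∈ T := by
  by_cases h : i ∈ T <;> simp [flags, h]

theorem update_flags (T : Finset ℕ) (i : ℕ) :
    Function.update (flags T) i 1 = flags (insert i T) := by
  ext k
  rcases eq_or_ne k i with rfl | h
  · simp [flags]
  · simp [flags, h]

/-- What is constant while points are being trimmed; `T` is the set of points trimmed so far and
`c` the number of rounds. -/
structure Trimming (n : ℕ) (ε : ℝ) (Y s : ℕ → ℝ) (T : Finset ℕ) (c : ℕ) (m : Mem) : Prop where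
  base : Base n ε Y m
  arr2 : m.arr 2 = s
  arr3 : m.arr 3 = flags T
  arr4 : m.arr 4 0 = ε * n
  arr5 : m.arr 5 0 = c + 1
  arr7 : m.arr 7 = fun _ => 0

/-- The state of the search for the largest slope after `i` points. -/
def BestSlope (s : ℕ → ℝ) (T : Finset ℕ) (i : ℕ) (b : ℝ) (a : ℕ) : Prop :=
  (b = -1 ∧ ∀ j < i, j ∈ T) ∨ (a < i ∧ a ∉ T ∧ s a = b ∧ ∀ j < i, j ∉ T → s j ≤ b)

theorem argmaxStep_spec {s : ℕ → ℝ} (hs : ∀ i, 0 ≤ s i) {T : Finset ℕ} {c i : ℕ} :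
    Triple o n
      (fun m => Trimming n ε Y s T c m ∧ m.idx 1 = i ∧ BestSlope s T i (m.arr 6 0) (m.idx 3))
      argmaxStep (fun m => Trimming n ε Y s T c m ∧ m.idx 1 = i + 1 ∧
        BestSlope s T (i + 1) (m.arr 6 0) (m.idx 3)) := by
  refine .of_wp ?_
  rintro ⟨idx, arr⟩ ⟨⟨⟨h0, h9, he, hl⟩, h2, h3, h4, h5, h7⟩, h1, hb⟩
  simp only at h0 h9 he hl h2 h3 h4 h5 h7 h1 hb
  refine ⟨fun c1 => ⟨fun c2 => ?_, fun c2 => ?_⟩, fun c1 => ?_⟩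
  all_goals
    simp only [RExp.val, h1, h3, flags_lt_one, one_le_flags] at c1
    try simp only [RExp.val, h1, h2, h9] at c2
    refine ⟨⟨⟨?_, ?_, ?_, ?_⟩, ?_, ?_, ?_, ?_, ?_⟩, ?_, ?_⟩
  all_goals simp [h0, h1, h2, h3, h4, h5, h7, h9, he, hl, RExp.val]
  · refine .inr ⟨Nat.lt_succ_self i, c1, rfl, fun j hj hjT => ?_⟩
    rcases Nat.lt_succ_iff_lt_or_eq.1 hj with hj | rfl
    · rcases hb with ⟨-, hb⟩ | ⟨-, -, -, hb⟩
      · exact absurd (hb j hj) hjT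
      · exact (hb j hj hjT).trans c2.le
    · exact le_rfl
  · rcases hb with ⟨hb, -⟩ | ⟨ha, haT, hab, hb⟩
    · linarith [hs i]
    · refine .inr ⟨by omega, haT, hab, fun j hj hjT => ?_⟩
      rcases Nat.lt_succ_iff_lt_or_eq.1 hj with hj | rfl
      · exact hb j hj hjT
      · exact c2
  · rcases hb with ⟨hb, hT⟩ | ⟨ha, haT, hab, hb⟩
    · refine .inl ⟨hb, fun j hj => ?_⟩
      rcases Nat.lt_succ_iff_lt_or_eq.1 hj with hj | rfl
      · exact hT j hj
      · exact c1
    · refine .inr ⟨by omega, haT, hab, fun j hj hjT => ?_⟩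
      rcases Nat.lt_succ_iff_lt_or_eq.1 hj with hj | rfl
      · exact hb j hj hjT
      · exact absurd c1 hjT

theorem argmaxProg_spec {s : ℕ → ℝ} (hs : ∀ i, 0 ≤ s i) {T : Finset ℕ} {c : ℕ} :
    Triple o n (Trimming n ε Y s T c) argmaxProg
      (fun m => Trimming n ε Y s T c m ∧ BestSlope s T n (m.arr 6 0) (m.idx 3)) := by
  have hloop := Triple.loop (o := o) (n := n) (k := 0) (fun i m => Trimming n ε Y s T c m ∧ m.idx 1 = i ∧
    BestSlope s T i (m.arr 6 0) (m.idx 3)) (fun m h => h.1.base.idx0)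
    fun i _ => argmaxStep_spec hs
  have hinit : Triple o n (Trimming n ε Y s T c)
      (.seq (.set 6 9 (.sub .zero .one)) (.reset 1))
      (fun m => Trimming n ε Y s T c m ∧ m.idx 1 = 0 ∧
        BestSlope s T 0 (m.arr 6 0) (m.idx 3)) := by
    refine .of_wp ?_
    rintro ⟨idx, arr⟩ ⟨⟨h0, h9, he, hl⟩, h2, h3, h4, h5, h7⟩
    simp only at h0 h9 he hl h2 h3 h4 h5 h7
    refine ⟨⟨⟨?_, ?_, ?_, ?_⟩, ?_, ?_, ?_, ?_, ?_⟩, ?_, .inl ⟨?_, by simp⟩⟩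
    all_goals simp [h0, h2, h3, h4, h5, h7, h9, he, hl, RExp.val]
  exact (hinit.seq hloop).conseq (fun m h => h) fun m h => ⟨h.1, h.2.2⟩

/-- `T` consists of `c` of the first `n` points, and these have the largest slopes. -/
structure IsTop (n : ℕ) (s : ℕ → ℝ) (T : Finset ℕ) (c : ℕ) : Prop where
  card_eq : T.card = c
  lt : ∀ i ∈ T, i < n
  le : ∀ i ∈ T, ∀ j < n, j ∉ T → s j ≤ s i

/-- If the sentinel survived, all n points would already be trimmed, contradicting c < n. -/
theorem BestSlope.isTop_insert {s : ℕ → ℝ} {T : Finset ℕ} {b : ℝ} {a c : ℕ}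
    (h : BestSlope s T n b a) (hT : IsTop n s T c) (hc : c < n) : IsTop n s (insert a T) (c + 1) := by
  rcases h with ⟨-, h⟩ | ⟨ha, haT, rfl, h⟩
  · have : Finset.range n ⊆ T := fun j hj => h j (Finset.mem_range.1 hj)
    have := Finset.card_le_card this
    rw [Finset.card_range, hT.card_eq] at this
    omega
  · refine ⟨by rw [Finset.card_insert_of_notMem haT, hT.card_eq], ?_, ?_⟩
    · intro i hi
      rcases Finset.mem_insert.1 hi with rfl | hi
      · exact ha
      · exact hT.lt i hi
    · intro i hi j hj hjT
      rw [Finset.mem_insert, not_or] at hjT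
      rcases Finset.mem_insert.1 hi with rfl | hi
      · exact h j hj hjT.2
      · exact hT.le i hi j hj hjT.2

/-- The test c + 1 ≤ εn is equivalent to c + 1 ≤ ⌊εn⌋, so after c rounds exactly min(c, ⌊εn⌋) points
are gone and no floor is ever computed. -/
theorem trimStep_spec {s : ℕ → ℝ} (hs : ∀ i, 0 ≤ s i) (hε : 0 < ε) {c : ℕ} (hc : c < n) :
    Triple o n (fun m => ∃ T, Trimming n ε Y s T c m ∧ IsTop n s T (min c ⌊ε * n⌋₊)) trimStep
      (fun m => ∃ T, Trimming n ε Y s T (c + 1) m ∧ IsTop n s T (min (c + 1) ⌊ε * n⌋₊)) := by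
  refine Triple.seq (Q := fun m => ∃ T, Trimming n ε Y s T c m ∧
    IsTop n s T (min (c + 1) ⌊ε * n⌋₊)) (.ifReal ?_ ?_) ?_
  · refine .of_wp ?_
    rintro m ⟨⟨T, hm, hT⟩, hlt⟩
    refine ⟨T, hm, ?_⟩
    simp only [RExp.val, hm.base.idx9, hm.arr4, hm.arr5] at hlt
    have : ⌊ε * n⌋₊ < c + 1 := (Nat.floor_lt (by positivity)).2 (by exact_mod_cast hlt)
    rwa [min_eq_right (by omega)] at hT ⊢
  · intro m t hm
    obtain ⟨⟨T, hm, hT⟩, hle⟩ := hm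
    simp only [RExp.val, hm.base.idx9, hm.arr4, hm.arr5] at hle
    have hfl : c + 1 ≤ ⌊ε * n⌋₊ := Nat.le_floor (by exact_mod_cast hle)
    rw [min_eq_left (by omega)] at hT
    have hset : Triple o n (Trimming n ε Y s T c) (.seq argmaxProg (.set 3 3 .one))
        (fun m => ∃ T, Trimming n ε Y s T c m ∧ IsTop n s T (min (c + 1) ⌊ε * n⌋₊)) :=
      (argmaxProg_spec hs).seq (.of_wp ?_)
    · exact hset m t hm
    rintro ⟨idx, arr⟩ ⟨⟨⟨h0, h9, he, hl⟩, h2, h3, h4, h5, h7⟩, hb⟩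
    simp only at h0 h9 he hl h2 h3 h4 h5 h7 hb
    refine ⟨insert (idx 3) T, ⟨⟨?_, ?_, ?_, ?_⟩, ?_, ?_, ?_, ?_, ?_⟩, ?_⟩
    all_goals try simp [h0, h2, h3, h4, h5, h7, h9, he, hl, RExp.val, update_flags]
    rw [min_eq_left hfl]
    exact hb.isTop_insert hT hc
  · refine .of_wp ?_
    rintro ⟨idx, arr⟩ ⟨T, ⟨⟨h0, h9, he, hl⟩, h2, h3, h4, h5, h7⟩, hT⟩
    simp only at h0 h9 he hl h2 h3 h4 h5 h7
    refine ⟨T, ⟨⟨?_, ?_, ?_, ?_⟩, ?_, ?_, ?_, ?_, ?_⟩, hT⟩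
    all_goals simp [h0, h2, h3, h4, h5, h7, h9, he, hl, RExp.val]

theorem trimProg_spec {s : ℕ → ℝ} (hs : ∀ i, 0 ≤ s i) (hε : 0 < ε) (hε1 : ε < 1) :
    Triple o n (fun m => (Base n ε Y m ∧ Blank m) ∧ m.arr 2 = s) trimProg
      (fun m => ∃ T, (Base n ε Y m ∧ m.arr 7 = fun _ => 0) ∧ m.arr 3 = flags T ∧
        IsTop n s T ⌊ε * n⌋₊) := by
  have hmul : Triple o n (fun m => (Base n ε Y m ∧ Blank m) ∧ m.arr 2 = s) _
      (fun m => Base n ε Y m ∧ m.arr 2 = s ∧ m.arr 3 = flags ∅ ∧ m.arr 4 0 = n * ε ∧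
        m.arr 7 = fun _ => 0) :=
    (Triple.loop (k := 0) (p := .set 4 9 (.add (.get 4 9) (.get 0 9)))
      (fun i m => Base n ε Y m ∧ m.arr 2 = s ∧ m.arr 3 = flags ∅ ∧ m.arr 4 0 = i * ε ∧
        m.arr 7 = fun _ => 0) (fun m h => h.1.idx0) fun i _ => by
        refine .of_wp ?_
        rintro ⟨idx, arr⟩ ⟨⟨h0, h9, he, hl⟩, h2, h3, h4, h7⟩
        simp only at h0 h9 he hl h2 h3 h4 h7
        refine ⟨⟨?_, ?_, ?_, ?_⟩, ?_, ?_, ?_, ?_⟩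
        all_goals simp [h0, h2, h3, h4, h7, h9, he, hl, RExp.val]
        ring).conseq
      (fun m h => ⟨h.1.1, h.2, by rw [h.1.2.arr3]; ext; simp [flags], by simp [h.1.2.arr4],
        h.1.2.arr7⟩) fun m h => h
  have hloop := Triple.loop (o := o) (n := n) (k := 0) (fun c m => ∃ T, Trimming n ε Y s T c m ∧
    IsTop n s T (min c ⌊ε * n⌋₊)) (fun m h => h.choose_spec.1.base.idx0)
    fun c hc => trimStep_spec hs hε hc
  refine (hmul.seq (Triple.seq (Triple.of_wp ?_) hloop)).conseq (fun m h => h) ?_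
  · rintro ⟨idx, arr⟩ ⟨⟨h0, h9, he, hl⟩, h2, h3, h4, h7⟩
    simp only at h0 h9 he hl h2 h3 h4 h7
    refine ⟨∅, ⟨⟨?_, ?_, ?_, ?_⟩, ?_, ?_, ?_, ?_, ?_⟩, ?_⟩
    all_goals try simp [h0, h2, h3, h4, h7, h9, he, hl, RExp.val, mul_comm]
    exact ⟨by simp, by simp, by simp⟩
  · rintro m ⟨T, hm, hT⟩
    have : ⌊ε * n⌋₊ ≤ n := by
      refine Nat.floor_le_of_le ?_
      nlinarith [Nat.cast_nonneg (α := ℝ) n]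
    rw [min_eq_right this] at hT
    exact ⟨T, ⟨hm.base, hm.arr7⟩, hm.arr3, hT⟩

/-! ### Greedy net -/

/-- One round of the search for a point of the current net within `ε` of point `i`
(register 1). -/
def nearStep : Prog :=
  .seq (.ifReal (.get 0 9) (.samp 1 2) .skip (.ifReal (.get 7 2) .one .skip (.set 8 9 .one)))
    (.incr 2)

def netStep : Prog :=
  .seq (.ifReal (.get 3 1) .one
    (.seq (.seq (.seq (.set 8 9 .zero) (.reset 2)) (.loop 0 nearStep))
      (.ifReal (.get 8 9) .one (.set 7 1 .one) .skip)) .skip) (.incr 1)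

def netProg : Prog := .seq (.reset 1) (.loop 0 netStep)

structure Netting (n : ℕ) (ε : ℝ) (Y : ℕ → ℝ) (T W : Finset ℕ) (m : Mem) : Prop where
  base : Base n ε Y m
  arr3 : m.arr 3 = flags T
  arr7 : m.arr 7 = flags W

/-- `W` is an `ε`-net of those of the first `i` points that are not in `T`. -/
structure IsPartialNet (d : ℕ → ℕ → ℝ) (ε : ℝ) (T W : Finset ℕ) (i : ℕ) : Prop where
  lt : ∀ w ∈ W, w < i
  notMem : ∀ w ∈ W, w ∉ T
  cover : ∀ j < i, j ∉ T → ∃ w ∈ W, d j w ≤ ε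
  separated : ∀ u ∈ W, ∀ v ∈ W, u ≠ v → ε < d u v

/-- The flag `b` tells whether one of the first `j` points is in `W` and within `ε` of point
`i`. -/
def NearFlag (d : ℕ → ℕ → ℝ) (ε : ℝ) (W : Finset ℕ) (i j : ℕ) (b : ℝ) : Prop :=
  (b = 1 ∧ ∃ w ∈ W, d i w ≤ ε) ∨ (b = 0 ∧ ∀ w ∈ W, w < j → ε < d i w)

theorem nearStep_spec {T W : Finset ℕ} {i j : ℕ} :
    Triple o n (fun m => Netting n ε Y T W m ∧ m.idx 1 = i ∧ m.idx 2 = j ∧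
      NearFlag o.samp ε W i j (m.arr 8 0)) nearStep
      (fun m => Netting n ε Y T W m ∧ m.idx 1 = i ∧ m.idx 2 = j + 1 ∧
        NearFlag o.samp ε W i (j + 1) (m.arr 8 0)) := by
  refine .of_wp ?_
  rintro ⟨idx, arr⟩ ⟨⟨⟨h0, h9, he, hl⟩, h3, h7⟩, h1, h2, hb⟩
  simp only at h0 h9 he hl h3 h7 h1 h2 hb
  refine ⟨fun c1 => ?_, fun c1 => ⟨fun c2 => ?_, fun c2 => ?_⟩⟩
  all_goals
    simp only [RExp.val, h1, h2, h9, he] at c1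
    try simp only [RExp.val, h2, h7, flags_lt_one, one_le_flags] at c2
    refine ⟨⟨⟨?_, ?_, ?_, ?_⟩, ?_, ?_⟩, ?_, ?_, ?_⟩
  all_goals simp [h0, h1, h2, h3, h7, h9, he, hl, RExp.val]
  · refine hb.imp_right fun ⟨hb, hW⟩ => ⟨hb, fun w hw hwj => ?_⟩
    rcases Nat.lt_succ_iff_lt_or_eq.1 hwj with h | rfl
    · exact hW w hw h
    · exact c1
  · refine hb.imp_right fun ⟨hb, hW⟩ => ⟨hb, fun w hw hwj => ?_⟩
    rcases Nat.lt_succ_iff_lt_or_eq.1 hwj with h | rfl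
    · exact hW w hw h
    · exact absurd hw c2
  · exact .inl ⟨rfl, j, c2, c1⟩

theorem IsPartialNet.succ_of_cover {d : ℕ → ℕ → ℝ} {T W : Finset ℕ} {i : ℕ}
    (h : IsPartialNet d ε T W i) (hi : i ∉ T → ∃ w ∈ W, d i w ≤ ε) :
    IsPartialNet d ε T W (i + 1) := by
  refine ⟨fun w hw => (h.lt w hw).trans (Nat.lt_succ_self i), h.notMem, fun j hj hjT => ?_,
    h.separated⟩
  rcases Nat.lt_succ_iff_lt_or_eq.1 hj with hj | rfl
  · exact h.cover j hj hjT
  · exact hi hjT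

/-- The greedy step: a kept point farther than ε from `W` preserves separation and covers itself. -/
theorem IsPartialNet.insert {d : ℕ → ℕ → ℝ} {T W : Finset ℕ} {i : ℕ}
    (h : IsPartialNet d ε T W i) (hd : ∀ j k, d j k = d k j) (hd0 : ∀ j, d j j = 0) (hε : 0 < ε)
    (hiT : i ∉ T) (hi : ∀ w ∈ W, ε < d i w) : IsPartialNet d ε T (insert i W) (i + 1) := by
  refine ⟨fun w hw => ?_, fun w hw => ?_, fun j hj hjT => ?_, fun u hu v hv huv => ?_⟩
  · rcases Finset.mem_insert.1 hw with rfl | hw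
    · exact Nat.lt_succ_self w
    · exact (h.lt w hw).trans (Nat.lt_succ_self i)
  · rcases Finset.mem_insert.1 hw with rfl | hw
    · exact hiT
    · exact h.notMem w hw
  · rcases Nat.lt_succ_iff_lt_or_eq.1 hj with hj | rfl
    · obtain ⟨w, hw, hjw⟩ := h.cover j hj hjT
      exact ⟨w, Finset.mem_insert_of_mem hw, hjw⟩
    · exact ⟨j, Finset.mem_insert_self j W, (hd0 j).trans_le hε.le⟩
  · rcases Finset.mem_insert.1 hu with rfl | hu' <;> rcases Finset.mem_insert.1 hv with rfl | hv'
    · exact absurd rfl huv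
    · exact hi v hv'
    · exact (hi u hu').trans_eq (hd _ _)
    · exact h.separated u hu' v hv' huv

theorem netStep_spec (hd : ∀ j k, o.samp j k = o.samp k j) (hd0 : ∀ j, o.samp j j = 0)
    (hε : 0 < ε) {T : Finset ℕ} {i : ℕ} (hin : i < n) :
    Triple o n (fun m => ∃ W, (Netting n ε Y T W m ∧ m.idx 1 = i) ∧ IsPartialNet o.samp ε T W i)
      netStep (fun m => ∃ W, (Netting n ε Y T W m ∧ m.idx 1 = i + 1) ∧
        IsPartialNet o.samp ε T W (i + 1)) := by
  refine Triple.seq (Q := fun m => ∃ W, (Netting n ε Y T W m ∧ m.idx 1 = i) ∧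
    IsPartialNet o.samp ε T W (i + 1)) (.ifReal ?_ ?_) ?_
  · intro m t hm
    obtain ⟨⟨W, hm, hW⟩, hlt⟩ := hm
    simp only [RExp.val, hm.1.arr3, hm.2, flags_lt_one] at hlt
    have hinit : Triple o n (fun m => Netting n ε Y T W m ∧ m.idx 1 = i)
        (.seq (.set 8 9 .zero) (.reset 2))
        (fun m => Netting n ε Y T W m ∧ m.idx 1 = i ∧ m.idx 2 = 0 ∧
          NearFlag o.samp ε W i 0 (m.arr 8 0)) := by
      refine .of_wp ?_
      rintro ⟨idx, arr⟩ ⟨⟨⟨h0, h9, he, hl⟩, h3, h7⟩, h1⟩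
      simp only at h0 h9 he hl h3 h7 h1
      refine ⟨⟨⟨?_, ?_, ?_, ?_⟩, ?_, ?_⟩, ?_, ?_, .inr ⟨?_, by simp⟩⟩
      all_goals simp [h0, h1, h3, h7, h9, he, hl, RExp.val]
    have hloop := Triple.loop (o := o) (n := n) (k := 0) (fun j m => Netting n ε Y T W m ∧
      m.idx 1 = i ∧ m.idx 2 = j ∧ NearFlag o.samp ε W i j (m.arr 8 0))
      (fun m h => h.1.base.idx0) fun j _ => nearStep_spec
    have hlast : Triple o n (fun m => Netting n ε Y T W m ∧ m.idx 1 = i ∧ m.idx 2 = n ∧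
        NearFlag o.samp ε W i n (m.arr 8 0)) (.ifReal (.get 8 9) .one (.set 7 1 .one) .skip)
        (fun m => ∃ W, (Netting n ε Y T W m ∧ m.idx 1 = i) ∧
          IsPartialNet o.samp ε T W (i + 1)) := by
      refine .of_wp ?_
      rintro ⟨idx, arr⟩ ⟨⟨⟨h0, h9, he, hl⟩, h3, h7⟩, h1, h2, hb⟩
      simp only at h0 h9 he hl h3 h7 h1 h2 hb
      refine ⟨fun c1 => ?_, fun c1 => ?_⟩
      · simp only [RExp.val, h9] at c1
        refine ⟨insert i W, ⟨⟨⟨?_, ?_, ?_, ?_⟩, ?_, ?_⟩, ?_⟩, ?_⟩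
        all_goals try simp [h0, h1, h3, h7, h9, he, hl, RExp.val, update_flags]
        rcases hb with ⟨hb, -⟩ | ⟨-, hb⟩
        · linarith
        -- The scan covers all indices below n, and members of `W` have index below i < n, so none
        -- was missed.
        · exact hW.insert hd hd0 hε hlt fun w hw => hb w hw ((hW.lt w hw).trans hin)
      · simp only [RExp.val, h9] at c1
        refine ⟨W, ⟨⟨⟨h0, h9, he, hl⟩, h3, h7⟩, h1⟩, hW.succ_of_cover fun _ => ?_⟩
        rcases hb with ⟨-, hb⟩ | ⟨hb, -⟩
        · exact hb
        · linarith
    exact ((hinit.seq hloop).seq hlast) m t hm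
  · refine .of_wp ?_
    rintro m ⟨⟨W, hm, hW⟩, hle⟩
    simp only [RExp.val, hm.1.arr3, hm.2, one_le_flags] at hle
    exact ⟨W, hm, hW.succ_of_cover fun h => absurd hle h⟩
  · refine .of_wp ?_
    rintro ⟨idx, arr⟩ ⟨W, ⟨⟨⟨h0, h9, he, hl⟩, h3, h7⟩, h1⟩, hW⟩
    simp only at h0 h9 he hl h3 h7 h1
    refine ⟨W, ⟨⟨⟨?_, ?_, ?_, ?_⟩, ?_, ?_⟩, ?_⟩, hW⟩
    all_goals simp [h0, h1, h3, h7, h9, he, hl]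

theorem netProg_spec (hd : ∀ j k, o.samp j k = o.samp k j) (hd0 : ∀ j, o.samp j j = 0)
    (hε : 0 < ε) {T : Finset ℕ} :
    Triple o n (fun m => (Base n ε Y m ∧ m.arr 7 = fun _ => 0) ∧ m.arr 3 = flags T) netProg
      (fun m => ∃ W, Netting n ε Y T W m ∧ IsPartialNet o.samp ε T W n) := by
  have hloop := Triple.loop (o := o) (n := n) (k := 0)
    (fun i m => ∃ W, (Netting n ε Y T W m ∧ m.idx 1 = i) ∧ IsPartialNet o.samp ε T W i)
    (fun m h => h.choose_spec.1.1.base.idx0) fun i hi => netStep_spec hd hd0 hε hi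
  refine Triple.seq (Triple.of_wp ?_) (hloop.conseq (fun m h => h)
    fun m ⟨W, h, hW⟩ => ⟨W, h.1, hW⟩)
  rintro ⟨idx, arr⟩ ⟨⟨⟨h0, h9, he, hl⟩, h7⟩, h3⟩
  simp only at h0 h9 he hl h3 h7
  refine ⟨∅, ⟨⟨⟨?_, ?_, ?_, ?_⟩, ?_, ?_⟩, ?_⟩, by simp, by simp, by simp, by simp⟩
  all_goals simp [h0, h3, h7, h9, he, hl]
  ext; simp [flags]

/-- The preprocessing stage: slopes, trimming, and a net of the remaining points. -/
def prepProg : Prog := .seq (.seq slopeProg trimProg) netProg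

/-! ### Evaluation of the extension -/

/-- One round of the search for the pair of net points `(u, v)` with the largest `R_x(u, v)`. -/
def pairStep : Prog :=
  .seq (.ifReal (.get 7 2) .one .skip
    (.ifReal (.get 9 9) (.div (.sub (.get 1 2) (.get 1 1)) (.add (.query 2) (.query 1)))
      (.seq (.set 9 9 (.div (.sub (.get 1 2) (.get 1 1)) (.add (.query 2) (.query 1))))
        (.set 0 9 (.add (.get 1 1) (.mul (.get 9 9) (.query 1))))) .skip))
    (.incr 2)

def queryStep : Prog :=
  .seq (.ifReal (.get 7 1) .one .skip (.seq (.reset 2) (.loop 0 pairStep))) (.incr 1)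

/-- The output overwrites ε in array 0, harmlessly: every query starts afresh from the memory left
by the preprocessing. -/
def queryProg : Prog :=
  .seq (.seq (.set 9 9 (.sub .zero .one)) (.reset 1)) (.loop 0 queryStep)

/-- What is constant while a query is processed. -/
structure Querying (n : ℕ) (Y : ℕ → ℝ) (W : Finset ℕ) (m : Mem) : Prop where
  idx0 : m.idx 0 = n
  idx9 : m.idx 9 = 0
  labels : m.arr 1 = Y
  arr7 : m.arr 7 = flags W

/-- `R_x(u, v)` in terms of the labels and of the distances `q` from `x`. -/
noncomputable def pairR (Y q : ℕ → ℝ) (u v : ℕ) : ℝ := (Y v - Y u) / (q v + q u)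

/-- The best value `b` of `R_x` found among the pairs `seen` so far, and the value `z` of `F_x` at
a pair with this value of `R_x`. -/
def BestPair (Y q : ℕ → ℝ) (W : Finset ℕ) (seen : ℕ → ℕ → Prop) (b z : ℝ) : Prop :=
  (∀ u ∈ W, ∀ v ∈ W, seen u v → pairR Y q u v ≤ b) ∧
    (b = -1 ∨ ∃ u ∈ W, ∃ v ∈ W, b = pairR Y q u v ∧ z = Y u + pairR Y q u v * q u)

theorem BestPair.mono {q : ℕ → ℝ} {W : Finset ℕ} {seen seen' : ℕ → ℕ → Prop} {b z : ℝ}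
    (h : BestPair Y q W seen b z)
    (hs : ∀ u ∈ W, ∀ v ∈ W, seen' u v → seen u v ∨ pairR Y q u v ≤ b) :
    BestPair Y q W seen' b z :=
  ⟨fun u hu v hv h' => (hs u hu v hv h').elim (h.1 u hu v hv) id, h.2⟩

theorem pairStep_spec {W : Finset ℕ} {i j : ℕ} (hi : i ∈ W) :
    Triple o n (fun m => Querying n Y W m ∧ m.idx 1 = i ∧ m.idx 2 = j ∧
      BestPair Y o.query W (fun u v => u < i ∨ u = i ∧ v < j) (m.arr 9 0) (m.arr 0 0)) pairStep
      (fun m => Querying n Y W m ∧ m.idx 1 = i ∧ m.idx 2 = j + 1 ∧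
      BestPair Y o.query W (fun u v => u < i ∨ u = i ∧ v < j + 1) (m.arr 9 0) (m.arr 0 0)) := by
  refine .of_wp ?_
  rintro ⟨idx, arr⟩ ⟨⟨h0, h9, hl, h7⟩, h1, h2, hb⟩
  simp only at h0 h9 hl h7 h1 h2 hb
  refine ⟨fun c1 => ?_, fun c1 => ⟨fun c2 => ?_, fun c2 => ?_⟩⟩
  all_goals
    simp only [RExp.val, h2, h7, flags_lt_one, one_le_flags] at c1
    try simp only [RExp.val, h1, h2, h9, hl] at c2
    refine ⟨⟨?_, ?_, ?_, ?_⟩, ?_, ?_, ?_⟩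
  all_goals simp [h0, h1, h2, h7, h9, hl, RExp.val]
  · refine hb.mono fun u hu v hv h => ?_
    rcases h with h | ⟨rfl, h⟩
    · exact .inl (.inl h)
    · rcases Nat.le_iff_lt_or_eq.1 h with h | rfl
      · exact .inl (.inr ⟨rfl, h⟩)
      · exact absurd hv c1
  · refine ⟨fun u hu v hv h => ?_, .inr ⟨i, hi, j, c1, rfl, rfl⟩⟩
    rcases h with h | ⟨rfl, h⟩
    · exact (hb.1 u hu v hv (.inl h)).trans c2.le
    · rcases Nat.le_iff_lt_or_eq.1 h with h | rfl
      · exact (hb.1 u hu v hv (.inr ⟨rfl, h⟩)).trans c2.le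
      · exact le_rfl
  · refine hb.mono fun u hu v hv h => ?_
    rcases h with h | ⟨rfl, h⟩
    · exact .inl (.inl h)
    · rcases Nat.le_iff_lt_or_eq.1 h with h | rfl
      · exact .inl (.inr ⟨rfl, h⟩)
      · exact .inr c2

theorem queryStep_spec {W : Finset ℕ} (hW : ∀ w ∈ W, w < n) {i : ℕ} :
    Triple o n (fun m => Querying n Y W m ∧ m.idx 1 = i ∧
      BestPair Y o.query W (fun u _ => u < i) (m.arr 9 0) (m.arr 0 0)) queryStep
      (fun m => Querying n Y W m ∧ m.idx 1 = i + 1 ∧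
      BestPair Y o.query W (fun u _ => u < i + 1) (m.arr 9 0) (m.arr 0 0)) := by
  refine Triple.seq (Q := fun m => Querying n Y W m ∧ m.idx 1 = i ∧
    BestPair Y o.query W (fun u _ => u < i + 1) (m.arr 9 0) (m.arr 0 0)) (.ifReal ?_ ?_) ?_
  · refine .of_wp ?_
    rintro m ⟨⟨hm, h1, hb⟩, hlt⟩
    simp only [RExp.val, hm.arr7, h1, flags_lt_one] at hlt
    refine ⟨hm, h1, hb.mono fun u hu v hv h => .inl ?_⟩
    rcases Nat.lt_succ_iff_lt_or_eq.1 h with h | rfl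
    · exact h
    · exact absurd hu hlt
  · intro m t hm
    obtain ⟨hm, hle⟩ := hm
    simp only [RExp.val, hm.1.arr7, hm.2.1, one_le_flags] at hle
    have hloop := Triple.loop (o := o) (n := n) (k := 0) (fun j m => Querying n Y W m ∧
      m.idx 1 = i ∧ m.idx 2 = j ∧ BestPair Y o.query W (fun u v => u < i ∨ u = i ∧ v < j)
        (m.arr 9 0) (m.arr 0 0)) (fun m h => h.1.idx0) fun j _ => pairStep_spec hle
    have hseq : Triple o n (fun m => Querying n Y W m ∧ m.idx 1 = i ∧
        BestPair Y o.query W (fun u _ => u < i) (m.arr 9 0) (m.arr 0 0))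
        (.seq (.reset 2) (.loop 0 pairStep)) (fun m => Querying n Y W m ∧ m.idx 1 = i ∧
          BestPair Y o.query W (fun u _ => u < i + 1) (m.arr 9 0) (m.arr 0 0)) := by
      refine Triple.seq (Triple.of_wp ?_) (hloop.conseq (fun m h => h) fun m h => ⟨h.1, h.2.1,
        h.2.2.2.mono fun u hu v hv huv => .inl
          ((Nat.lt_succ_iff_lt_or_eq.1 huv).imp_right fun h => ⟨h, hW v hv⟩)⟩)
      rintro ⟨idx, arr⟩ ⟨⟨h0, h9, hl, h7⟩, h1, hb⟩
      simp only at h0 h9 hl h7 h1 hb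
      refine ⟨⟨?_, ?_, ?_, ?_⟩, ?_, ?_, hb.mono fun u hu v hv h => .inl (by simpa using h)⟩
      all_goals simp [h0, h1, h7, h9, hl]
    exact hseq m t hm
  · refine .of_wp ?_
    rintro ⟨idx, arr⟩ ⟨⟨h0, h9, hl, h7⟩, h1, hb⟩
    simp only at h0 h9 hl h7 h1 hb
    refine ⟨⟨?_, ?_, ?_, ?_⟩, ?_, hb⟩
    all_goals simp [h0, h1, h7, h9, hl]

theorem queryProg_spec {W : Finset ℕ} (hW : ∀ w ∈ W, w < n) (hne : W.Nonempty) :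
    Triple o n (Querying n Y W) queryProg (fun m => ∃ u ∈ W, ∃ v ∈ W,
      (∀ u' ∈ W, ∀ v' ∈ W, pairR Y o.query u' v' ≤ pairR Y o.query u v) ∧
      m.arr 0 0 = Y u + pairR Y o.query u v * o.query u) := by
  have hloop := Triple.loop (o := o) (n := n) (k := 0) (fun i m => Querying n Y W m ∧
    m.idx 1 = i ∧ BestPair Y o.query W (fun u _ => u < i) (m.arr 9 0) (m.arr 0 0))
    (fun m h => h.1.idx0) fun i _ => queryStep_spec hW
  refine Triple.seq (Triple.of_wp ?_) (hloop.conseq (fun m h => h) ?_)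
  · rintro ⟨idx, arr⟩ ⟨h0, h9, hl, h7⟩
    simp only at h0 h9 hl h7
    refine ⟨⟨?_, ?_, ?_, ?_⟩, ?_, by simp, .inl ?_⟩
    all_goals simp [h0, h7, h9, hl, RExp.val]
  · rintro m ⟨-, -, hle, hb⟩
    rcases hb with hb | ⟨u, hu, v, hv, hb, hz⟩
    -- The sentinel -1 cannot survive, since a diagonal pair has R = 0.
    · obtain ⟨w, hw⟩ := hne
      have := hle w hw w hw (hW w hw)
      rw [hb, pairR, sub_self, zero_div] at this
      norm_num at this
    · exact ⟨u, hu, v, hv, fun u' hu' v' hv' => hb ▸ hle u' hu' v' hv' (hW u' hu'), hz⟩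

theorem prepProg_spec {n : ℕ} {ε : ℝ} {Y : ℕ → ℝ} {o : Oracle}
    (hd : ∀ j k, o.samp j k = o.samp k j) (hd0 : ∀ j, o.samp j j = 0) (hε : 0 < ε) (hε1 : ε < 1)
    (hs : ∀ i, 0 ≤ maxSlope Y o.samp i n) :
    Triple o n (fun m => (Base n ε Y m ∧ Blank m) ∧ m.arr 2 = fun _ => 0) prepProg
      (fun m => ∃ T W, IsTop n (fun k => if k < n then maxSlope Y o.samp k n else 0) T ⌊ε * n⌋₊ ∧
        IsPartialNet o.samp ε T W n ∧ Querying n Y W m) := by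
  refine Triple.seq (slopeProg_spec.seq (trimProg_spec (fun i => ?_) hε hε1)) ?_
  · split_ifs
    · exact hs i
    · exact le_rfl
  · rintro m t ⟨T, hm, h3, hT⟩
    obtain ⟨⟨W, hW, hnet⟩, hcost⟩ := netProg_spec hd hd0 hε (T := T) m t ⟨hm, h3⟩
    exact ⟨⟨T, W, hT, hnet, hW.base.idx0, hW.base.idx9, hW.base.labels, hW.arr7⟩, hcost⟩

theorem maxSlope_nonneg (Y : ℕ → ℝ) (d : ℕ → ℕ → ℝ) (i j : ℕ) : 0 ≤ maxSlope Y d i j := by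
  induction j with
  | zero => exact le_rfl
  | succ j ih => exact le_max_of_le_left (le_max_of_le_left ih)

theorem le_maxSlope (Y : ℕ → ℝ) (d : ℕ → ℕ → ℝ) (i : ℕ) {j k : ℕ} (hk : k < j) :
    |Y i - Y k| / d i k ≤ maxSlope Y d i j := by
  induction j with
  | zero => omega
  | succ j ih =>
    rcases Nat.lt_succ_iff_lt_or_eq.1 hk with h | rfl
    · exact le_max_of_le_left (le_max_of_le_left (ih h))
    · rcases abs_choice (Y i - Y k) with h | h
      · rw [h]
        exact le_max_of_le_left (le_max_right _ _)
      · rw [h, neg_sub]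
        exact le_max_right _ _

end Programs

/-! ### From indices to points of the space -/

section Bridge

variable {Ω : Type u} [MetricSpace Ω] {n : ℕ}

theorem pad_apply (g : Fin n → ℝ) (i : Fin n) : pad g i = g i := by simp [pad]

theorem samp_apply (X : Fin n → Ω) (i j : Fin n) :
    (prepOracle X).samp i j = dist (X i) (X j) := by simp [prepOracle, pad]

theorem samp_comm (X : Fin n → Ω) (i j : ℕ) :
    (prepOracle X).samp i j = (prepOracle X).samp j i := by
  by_cases hi : i < n <;> by_cases hj : j < n <;> simp [prepOracle, pad, hi, hj, dist_comm]

theorem samp_self (X : Fin n → Ω) (i : ℕ) : (prepOracle X).samp i i = 0 := by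
  by_cases hi : i < n <;> simp [prepOracle, pad, hi]

/-- The program also divides by the zero distance of a point to itself and to its copies. Such
quotients are 0 and are absorbed by the initial value of the maximum. -/
theorem slope_eq_ofReal_maxSlope (X : Fin n → Ω) (y : Ω → ℝ) (i : Fin n) :
    slope y (X i) (range X) =
      ENNReal.ofReal (maxSlope (pad fun k => y (X k)) (prepOracle X).samp i n) := by
  apply le_antisymm
  · refine iSup₂_le ?_
    rintro _ ⟨⟨k, rfl⟩, -⟩
    have := le_maxSlope (pad fun k => y (X k)) (prepOracle X).samp i k.2
    rw [samp_apply, pad_apply, pad_apply] at this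
    exact ENNReal.ofReal_le_ofReal this
  · have hle : ∀ k : Fin n, ∀ c, c ≤ |y (X i) - y (X k)| →
        ENNReal.ofReal (c / dist (X i) (X k)) ≤ slope y (X i) (range X) := by
      intro k c hc
      by_cases h : X k = X i
      · simp [h]
      · refine le_trans (ENNReal.ofReal_le_ofReal (by gcongr)) (le_iSup₂ (f := fun x'
          (_ : x' ∈ range X \ {X i}) => ENNReal.ofReal (|y (X i) - y x'| / dist (X i) x')) (X k)
          ⟨mem_range_self k, h⟩)
    have key : ∀ j ≤ n, ENNReal.ofReal (maxSlope (pad fun k => y (X k)) (prepOracle X).samp i j) ≤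
        slope y (X i) (range X) := by
      intro j
      induction j with
      | zero => simp [maxSlope]
      | succ j ih =>
        intro hj
        have hsamp := samp_apply X i ⟨j, hj⟩
        have hpad := pad_apply (fun k => y (X k)) ⟨j, hj⟩
        simp only at hsamp hpad
        rw [maxSlope, hsamp, hpad, pad_apply, ENNReal.ofReal_max, ENNReal.ofReal_max]
        refine max_le (max_le (ih (by omega)) (hle ⟨j, hj⟩ _ (le_abs_self _))) (hle ⟨j, hj⟩ _ ?_)
        rw [← neg_sub]
        exact neg_le_abs _
    exact key n le_rfl

/-- What the two programs compute is an extension as required. -/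
theorem trimmedNet_learned (X : Fin n → Ω) (y : Ω → ℝ) {ε : ℝ} (hε : 0 < ε) (hε1 : ε < 1)
    (hn : 0 < n) :
    (prepRun prepProg ε X y).2 ≤ prepProg.maxCost n ∧
    (∀ x, (queryRun prepProg queryProg ε X y x).2 ≤ queryProg.maxCost n) ∧
    ∃ T V, TrimmedNet ε X y (learned prepProg queryProg ε X y) T V := by
  classical
  set Y : ℕ → ℝ := pad fun k => y (X k) with hY
  have hYi : ∀ i : Fin n, Y i = y (X i) := pad_apply _
  have hinit : (Base n ε Y (initMem ε X y) ∧ Blank (initMem ε X y)) ∧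
      (initMem ε X y).arr 2 = fun _ => 0 := by
    refine ⟨⟨⟨?_, ?_, ?_, ?_⟩, ⟨?_, ?_, ?_⟩⟩, ?_⟩
    all_goals simp [initMem, hY]
  obtain ⟨⟨T, W, hT, hW, hmem⟩, hcost⟩ := prepProg_spec (samp_comm X) (samp_self X) hε hε1
    (maxSlope_nonneg Y _ · n) _ 0 hinit
  have hTcard : T.card < n := by
    have hn' : (0 : ℝ) < n := by exact_mod_cast hn
    rw [hT.card_eq, Nat.floor_lt (by positivity)]
    nlinarith
  have hWne : W.Nonempty := by
    obtain ⟨j, hj, hjT⟩ := Finset.exists_mem_notMem_of_card_lt_card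
      (hTcard.trans_eq (Finset.card_range n).symm)
    obtain ⟨w, hw, -⟩ := hW.cover j (Finset.mem_range.1 hj) hjT
    exact ⟨w, hw⟩
  have hquery := fun x => queryProg_spec (o := queryOracle X x) hW.lt hWne _ 0 hmem
  have hlt : ∀ w ∈ W, w < n := hW.lt
  let V : Set Ω := {x | ∃ w : Fin n, (w : ℕ) ∈ W ∧ x = X w}
  have hVfin : V.Finite := (finite_range X).subset fun x ⟨w, _, hx⟩ => ⟨w, hx.symm⟩
  have hVne : V.Nonempty := by
    obtain ⟨w, hw⟩ := hWne
    exact ⟨X ⟨w, hlt w hw⟩, ⟨w, hlt w hw⟩, hw, rfl⟩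
  refine ⟨hcost.trans (by simp), fun x => (hquery x).2.trans (by simp),
    Finset.univ.filter fun i : Fin n => (i : ℕ) ∈ T, V, ?_, ?_, ?_, ?_, ?_, ?_⟩
  · rw [← hT.card_eq, ← Finset.card_map Fin.valEmbedding]
    congr 1
    ext i
    simp only [Finset.mem_map, Finset.mem_filter, Finset.mem_univ, true_and]
    exact ⟨fun ⟨a, ha, hai⟩ => hai ▸ ha, fun hi => ⟨⟨i, hT.lt i hi⟩, hi, rfl⟩⟩
  · intro i hi j hj
    simp only [Finset.mem_filter, Finset.mem_univ, true_and] at hi hj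
    rw [slope_eq_ofReal_maxSlope, slope_eq_ofReal_maxSlope]
    have := hT.le i hi j j.2 hj
    simp only [i.2, j.2, if_true] at this
    exact ENNReal.ofReal_le_ofReal this
  · rintro v ⟨w, hw, rfl⟩
    exact ⟨w, by simpa using hW.notMem w hw, rfl⟩
  · intro j hj
    obtain ⟨w, hw, hd⟩ := hW.cover j j.2 (by simpa using hj)
    have hs := samp_apply X j ⟨w, hlt w hw⟩
    simp only at hs
    exact ⟨X ⟨w, hlt w hw⟩, ⟨⟨w, hlt w hw⟩, hw, rfl⟩, hs ▸ hd⟩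
  · rintro _ ⟨u, hu, rfl⟩ _ ⟨v, hv, rfl⟩ huv
    rw [← samp_apply]
    refine hW.separated u hu v hv fun h => huv ?_
    rw [Fin.ext h]
  · refine (isPMSE_iff hVfin hVne).2 fun x u' v' h' => ?_
    obtain ⟨⟨u, hu, v, hv, hmax, hval⟩, -⟩ := hquery x
    have hR : ∀ a b : Fin n, pairR Y (queryOracle X x).query a b = pmseR y x (X a) (X b) := by
      intro a b
      simp only [pairR, hYi, pmseR, queryOracle, pad_apply]
    have hmp : IsMaxPair V y x (X ⟨u, hlt u hu⟩) (X ⟨v, hlt v hv⟩) := by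
      refine ⟨⟨_, hu, rfl⟩, ⟨_, hv, rfl⟩, ?_⟩
      rintro _ ⟨a, ha, rfl⟩ _ ⟨b, hb, rfl⟩
      rw [← hR, ← hR]
      exact hmax a ha b hb
    -- The search finds one optimal pair, and all optimal pairs give the same value.
    rw [h'.pmseF_unique hmp, pmseF, ← hR, ← hYi]
    refine hval.trans ?_
    congr 2
    exact pad_apply (fun k => dist x (X k)) ⟨u, hlt u hu⟩

end Bridge

/-! ### Quadratic running time and the main theorem -/

open Prog in
theorem maxCost_prepProg_le {n : ℕ} (hn : 0 < n) : prepProg.maxCost n ≤ 200 * n ^ 2 := by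
  simp only [prepProg, slopeProg, slopeStep, trimProg, trimStep, argmaxProg, argmaxStep, netProg,
    netStep, nearStep, maxCost, RExp.cost]
  norm_num
  -- Lower-order terms are absorbed through 1 ≤ n ≤ n².
  nlinarith [Nat.mul_le_mul_left n hn]

open Prog in
theorem maxCost_queryProg_le {n : ℕ} (hn : 0 < n) : queryProg.maxCost n ≤ 200 * n ^ 2 := by
  simp only [queryProg, queryStep, pairStep, maxCost, RExp.cost]
  norm_num
  nlinarith [Nat.mul_le_mul_left n hn]

end AvgSlope

theorem lemma6p1 :
    ∃ (prep query : AvgSlope.Prog) (C : ℕ),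
      ∀ (Ω : Type u) [MetricSpace Ω] [MeasurableSpace Ω] [BorelSpace Ω]
        (μ : Measure Ω) [IsProbabilityMeasure μ] (ε : ℝ) (n : ℕ),
        Metric.ediam (univ : Set Ω) ≤ 1 → AvgSlope.IsDoubling Ω →
        0 < ε → ε < 1 → (8 / ε) ^ (AvgSlope.ddim Ω + 2) ≤ (n : ℝ) →
        -- the algorithm: quadratic running time, and what it computes
        (∀ (X : Fin n → Ω) (y : Ω → ℝ), MapsTo y (range X) (Icc 0 1) →
          (AvgSlope.prepRun prep ε X y).2 ≤ C * n ^ 2 ∧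
          (∀ x, (AvgSlope.queryRun prep query ε X y x).2 ≤ C * n ^ 2) ∧
          AvgSlope.IsTrimmedNetPMSE ε X y (AvgSlope.learned prep query ε X y)) ∧
        -- range, measurability of the local slope, and closeness to the labels on every sample
        (∀ (X : Fin n → Ω) (y f : Ω → ℝ), MapsTo y (range X) (Icc 0 1) →
          AvgSlope.IsTrimmedNetPMSE ε X y f →
          (∀ x, f x ∈ Icc (0 : ℝ) 1) ∧
          Measurable (fun x => AvgSlope.slope f x univ) ∧
          eLpNorm (fun x => f x - y x) 1 (AvgSlope.empirical X) ≤
            ENNReal.ofReal (3 * ε) *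
              max 1 (AvgSlope.strongSlope y (AvgSlope.empirical X) (range X))) ∧
        -- average slope on the whole space, with high probability for all labels at once
        (∃ G : Set (Fin n → Ω), MeasurableSet G ∧
          1 - Real.exp (-(n : ℝ) * (ε / 8) ^ (AvgSlope.ddim Ω + 1)
              + AvgSlope.ddim Ω * Real.log (8 / ε))
            ≤ (Measure.pi (fun _ : Fin n => μ)).real G ∧
          ∀ X ∈ G, ∀ y f : Ω → ℝ, MapsTo y (range X) (Icc 0 1) →
            AvgSlope.IsTrimmedNetPMSE ε X y f →
            AvgSlope.strongSlope f μ univ ≤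
              5 * AvgSlope.strongSlope y (AvgSlope.empirical X) (range X)) := by
  refine ⟨AvgSlope.prepProg, AvgSlope.queryProg, 200, ?_⟩
  intro Ω _ _ _ μ _ ε n hdiam hdoub hε hε1 hn
  have : Nonempty Ω := nonempty_of_isProbabilityMeasure μ
  have h8 : 1 ≤ 8 / ε := by rw [le_div_iff₀ hε]; linarith
  -- As d ≥ 0, the exponent d + 2 is at least 1; hence εn ≥ 8, more than the 6 needed for the
  -- rounding in |T|.
  have hn8 : 8 / ε ≤ n := by
    refine le_trans ?_ hn
    calc 8 / ε = (8 / ε) ^ (1 : ℝ) := (Real.rpow_one _).symm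
      _ ≤ _ := Real.rpow_le_rpow_of_exponent_le h8 (by linarith [hdoub.ddim_nonneg])
  have hεn : 8 ≤ ε * n := by rwa [div_le_iff₀' hε] at hn8
  have hn0 : 0 < n := by
    have : (0 : ℝ) < n := by linarith
    exact_mod_cast this
  refine ⟨fun X y _ => ?_, fun X y f hy hf => ?_, ?_⟩
  · obtain ⟨h1, h2, h3⟩ := AvgSlope.trimmedNet_learned X y hε hε1 hn0
    exact ⟨h1.trans (AvgSlope.maxCost_prepProg_le hn0),
      fun x => (h2 x).trans (AvgSlope.maxCost_queryProg_le hn0),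
      (AvgSlope.isTrimmedNetPMSE_iff hε).2 h3⟩
  · obtain ⟨T, V, h⟩ := (AvgSlope.isTrimmedNetPMSE_iff hε).1 hf
    have hne := h.nonempty hε hε1 hn0
    refine ⟨h.isPMSE.mem_Icc h.finite hne (hy.mono_left h.subset_range), ?_,
      h.eLpNorm_le hε hε1 hn0 hy⟩
    simp only [h.isPMSE.slope_univ_eq h.finite hne]
    exact (AvgSlope.measurable_pmseRStar h.finite hne).ennreal_ofReal
  · obtain ⟨G, hGm, hG, hle⟩ := AvgSlope.exists_measurableSet_strongSlope_le (n := n) μ hdiam hdoub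
      hε hε1 (by linarith)
    exact ⟨G, hGm, hG, fun X hX y f _ hf => hle X hX y f hf⟩
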